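/- Let $k\in\{0,1\}$. A finite simple graph $G$ is given without isolated vertices; $\alpha(G)$ denotes the maximum size of a set of pairwise non-adjacent vertices of $G$ (its value is not part of the input). An edge clique cover of $G$ is a set $\mathcal K$ of cliques (sets of pairwise adjacent vertices) of $G$ such that for every edge $uv$ of $G$ some $K\in\mathcal K$ contains both $u$ and $v$. The problem Edge Clique Cover Above Independent Set asks, given $G$, to find an edge clique cover of $G$ with at most $\alpha(G)+k$ cliques, or to report that none exists. For each of $k=0$ and $k=1$ there is a deterministic algorithm that solves this problem in time polynomial in the size of $G$ (given by its adjacency matrix). -/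

import Mathlib

/-! ### Random access machines with a step count

Structured programs over registers and random access arrays of natural numbers, with unit cost
for every elementary operation. The arithmetic is addition, truncated subtraction and comparison
only (no multiplication), so numbers have at most linearly many bits in the running time and the
input length, and polynomial time here is polynomial time on Turing machines. -/

namespace RAM

/-- Expressions: constants, registers, array cells (`cell a e` is cell number `e` of the array
`a`), and binary operations; comparisons return `1` for true and `0` for false. -/
inductive Expr : Type
  | const (c : ℕ)
  | reg (r : ℕ)
  | cell (a : ℕ) (e : Expr)
  | add (e₁ e₂ : Expr)
  | sub (e₁ e₂ : Expr)
  | lt (e₁ e₂ : Expr)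
  | eq (e₁ e₂ : Expr)

/-- Programs. -/
inductive Prog : Type
  | skip
  | set (r : ℕ) (e : Expr)
  | store (a : ℕ) (i e : Expr)
  | print (e : Expr)
  | seq (P Q : Prog)
  | ite (e : Expr) (P Q : Prog)
  | while (e : Expr) (P : Prog)

/-- A memory state: the registers, the arrays and the word printed so far. -/
structure State : Type where
  reg : ℕ → ℕ
  arr : ℕ → ℕ → ℕ
  out : List Bool

/-- The value of an expression. -/
def Expr.eval (s : State) : Expr → ℕ
  | const c => c
  | reg r => s.reg r
  | cell a e => s.arr a (e.eval s)
  | add e₁ e₂ => e₁.eval s + e₂.eval s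
  | sub e₁ e₂ => e₁.eval s - e₂.eval s
  | lt e₁ e₂ => if e₁.eval s < e₂.eval s then 1 else 0
  | eq e₁ e₂ => if e₁.eval s = e₂.eval s then 1 else 0

/-- The number of elementary operations needed to evaluate an expression. -/
def Expr.cost : Expr → ℕ
  | const _ => 1
  | reg _ => 1
  | cell _ e => e.cost + 1
  | add e₁ e₂ => e₁.cost + e₂.cost + 1
  | sub e₁ e₂ => e₁.cost + e₂.cost + 1
  | lt e₁ e₂ => e₁.cost + e₂.cost + 1
  | eq e₁ e₂ => e₁.cost + e₂.cost + 1

/-- Write the number `x` into the register `r`. -/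
def State.setReg (s : State) (r x : ℕ) : State :=
  { s with reg := Function.update s.reg r x }

/-- Write the number `x` into cell `i` of the array `a`. -/
def State.setCell (s : State) (a i x : ℕ) : State :=
  { s with arr := Function.update s.arr a (Function.update (s.arr a) i x) }

/-- Append the bit `b` to the output. -/
def State.emit (s : State) (b : Bool) : State :=
  { s with out := s.out ++ [b] }

/-- `Exec P s s' t`: the program `P`, started in the state `s`, halts in the state `s'` after
exactly `t` elementary steps. -/
inductive Exec : Prog → State → State → ℕ → Prop
  | skip (s : State) : Exec .skip s s 1
  | set (r : ℕ) (e : Expr) (s : State) :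
      Exec (.set r e) s (s.setReg r (e.eval s)) (e.cost + 1)
  | store (a : ℕ) (i e : Expr) (s : State) :
      Exec (.store a i e) s (s.setCell a (i.eval s) (e.eval s)) (i.cost + e.cost + 1)
  | print (e : Expr) (s : State) :
      Exec (.print e) s (s.emit (decide (e.eval s ≠ 0))) (e.cost + 1)
  | seq {P Q : Prog} {s s' s'' : State} {t t' : ℕ} :
      Exec P s s' t → Exec Q s' s'' t' → Exec (.seq P Q) s s'' (t + t')
  | ite_true {e : Expr} {P Q : Prog} {s s' : State} {t : ℕ} :
      e.eval s ≠ 0 → Exec P s s' t → Exec (.ite e P Q) s s' (e.cost + 1 + t)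
  | ite_false {e : Expr} {P Q : Prog} {s s' : State} {t : ℕ} :
      e.eval s = 0 → Exec Q s s' t → Exec (.ite e P Q) s s' (e.cost + 1 + t)
  | while_false {e : Expr} {P : Prog} {s : State} :
      e.eval s = 0 → Exec (.while e P) s s (e.cost + 1)
  | while_true {e : Expr} {P : Prog} {s s' s'' : State} {t t' : ℕ} :
      e.eval s ≠ 0 → Exec P s s' t → Exec (.while e P) s' s'' t' →
      Exec (.while e P) s s'' (e.cost + 1 + t + t')

/-- The machine is deterministic. -/
theorem Exec.deterministic {P : Prog} {s s₁ s₂ : State} {t₁ t₂ : ℕ}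
    (h₁ : Exec P s s₁ t₁) (h₂ : Exec P s s₂ t₂) : s₁ = s₂ ∧ t₁ = t₂ := by
  induction h₁ generalizing s₂ t₂ with
  | skip | set | store | print => cases h₂; exact ⟨rfl, rfl⟩
  | seq _ _ ih ih' =>
    cases h₂ with
    | seq a b =>
      obtain ⟨rfl, rfl⟩ := ih a
      obtain ⟨rfl, rfl⟩ := ih' b
      exact ⟨rfl, rfl⟩
  | ite_true h _ ih =>
    cases h₂ with
    | ite_true _ a => obtain ⟨rfl, rfl⟩ := ih a; exact ⟨rfl, rfl⟩
    | ite_false h' _ => exact absurd h' h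
  | ite_false h _ ih =>
    cases h₂ with
    | ite_true h' _ => exact absurd h h'
    | ite_false _ a => obtain ⟨rfl, rfl⟩ := ih a; exact ⟨rfl, rfl⟩
  | while_false h =>
    cases h₂ with
    | while_false _ => exact ⟨rfl, rfl⟩
    | while_true h' _ _ => exact absurd h h'
  | while_true h _ _ ih ih' =>
    cases h₂ with
    | while_false h' => exact absurd h' h
    | while_true _ a b =>
      obtain ⟨rfl, rfl⟩ := ih a
      obtain ⟨rfl, rfl⟩ := ih' b
      exact ⟨rfl, rfl⟩

/-- The initial state on the input word `w`: register `0` holds the length of `w`, the array `0`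
holds the bits of `w`, everything else is `0` and nothing has been printed. -/
def State.init (w : List Bool) : State where
  reg r := if r = 0 then w.length else 0
  arr a i := if a = 0 ∧ w[i]? = some true then 1 else 0
  out := []

/-- A search problem, given by a binary encoding of its instances and the relation between
instances and the words that are correct answers to them, is solvable in polynomial time: one
program halts on every instance within polynomially many steps in the length of the encoding and
prints a correct answer. -/
def SolvableInPolyTime {I : Type} (encode : I → List Bool) (IsAnswer : I → List Bool → Prop) :
    Prop :=
  ∃ (P : Prog) (p : Polynomial ℕ), ∀ x : I, ∃ (s : State) (t : ℕ),
    Exec P (State.init (encode x)) s t ∧ t ≤ p.eval (encode x).length ∧ IsAnswer x s.out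

end RAM

/-! ### Edge clique covers above the independence number -/

namespace SimpleGraph

/-- A set of cliques such that both endpoints of every edge lie in one of them. -/
def IsEdgeCliqueCover {V : Type*} (G : SimpleGraph V) (𝒦 : Finset (Finset V)) : Prop :=
  (∀ K ∈ 𝒦, G.IsClique (K : Set V)) ∧ ∀ u v : V, G.Adj u v → ∃ K ∈ 𝒦, u ∈ K ∧ v ∈ K

end SimpleGraph

namespace ECCAboveIndependentSet

/-- The instances: finite simple graphs without isolated vertices. -/
structure Instance : Type where
  n : ℕ
  graph : SimpleGraph (Fin n)
  no_isolated : ∀ v, ¬ graph.IsIsolated v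

open Classical in
/-- The adjacency matrix, row by row. -/
noncomputable def encode (x : Instance) : List Bool :=
  (List.finRange x.n).flatMap fun u => (List.finRange x.n).map fun v => decide (x.graph.Adj u v)

/-- A list of vertex sets, written as the concatenation of their 0-1 incidence vectors. -/
def encodeSets {n : ℕ} (L : List (Finset (Fin n))) : List Bool :=
  L.flatMap fun K => (List.finRange n).map fun v => decide (v ∈ K)

/-- The correct answers: "yes" (the bit `true`) followed by an edge clique cover with at most
`α(G) + k` cliques, or "no" (the bit `false`) if there is no such cover. -/
def IsAnswer (k : ℕ) (x : Instance) (y : List Bool) : Prop :=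
  (∃ L : List (Finset (Fin x.n)), x.graph.IsEdgeCliqueCover L.toFinset ∧
      L.length ≤ x.graph.indepNum + k ∧ y = true :: encodeSets L) ∨
  ((¬ ∃ 𝒦 : Finset (Finset (Fin x.n)), x.graph.IsEdgeCliqueCover 𝒦 ∧
      𝒦.card ≤ x.graph.indepNum + k) ∧ y = [false])

end ECCAboveIndependentSet

/-! Let `I` be an independent set of size α. A clique meets `I` in at most one vertex, every vertex
lies in some clique of a cover (none is isolated), and a vertex lying in only one of them is
simplicial. Hence, given a cover with at most α + k cliques, at most k vertices of `I` are
non-simplicial. Adjacent simplicial vertices have equal closed neighbourhoods; keep the least of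
each class as representative. The r representatives are independent, so r ≤ α. In a cover they meet
at least r different cliques, and a clique through a representative lies in its closed
neighbourhood. So uncovered edges must be covered by the remaining cliques, at most α + k - r of
them.

For k = 0 a cover forces r = α, so nothing may be uncovered; conversely, if nothing is uncovered,
the r ≤ α closed neighbourhoods form a cover.

For k = 1 a cover forces r ≥ α - 1 (`IsEdgeCliqueCover.indepNum_le`). A free vertex can be added to
the representatives, so it gives r ≤ α - 1, while a cover in the absence of free vertices forces r =
α. Thus free vertices tell whether two extra cliques or one are at hand, and α is never computed.
One clique suffices iff the endpoints of uncovered edges are pairwise adjacent. Two suffice iff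
there is a good 2-colouring: a vertex in conflict lies in exactly one of the two cliques,
conflicting vertices lie in different ones, linked vertices in the same one, and an endpoint without
conflicts may join both. Such a colouring is found by propagating forced colours, with an arbitrary
choice when nothing is forced.

All these conditions are first-order with quantifiers over vertices, so nested loops of length n
evaluate them (`Form.run_prog`) in polynomial time (`LoopProg.exec_toProg`). -/

namespace RAM

/-! ### Bounded loop programs and their running time -/

/-- Programs whose only loops are `loop r P`: run `P` for each value of register `r` below the
content of register `2`. -/
inductive LoopProg : Type
  | skip
  | set (r : ℕ) (e : Expr)
  | store (a : ℕ) (i e : Expr)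
  | print (e : Expr)
  | seq (P Q : LoopProg)
  | ite (e : Expr) (P Q : LoopProg)
  | loop (r : ℕ) (P : LoopProg)

/-- Apply `f 0`, `f 1`, …, `f (n - 1)` in this order. -/
def iterUpTo {α : Type*} (f : ℕ → α → α) : ℕ → α → α
  | 0, a => a
  | i + 1, a => f i (iterUpTo f i a)

theorem iterUpTo_induction {α : Type*} {f : ℕ → α → α} {n : ℕ} {a : α} (I : ℕ → α → Prop)
    (h0 : I 0 a) (hs : ∀ i < n, ∀ b, I i b → I (i + 1) (f i b)) : I n (iterUpTo f n a) := by
  induction n with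
  | zero => exact h0
  | succ n ih => exact hs n (by omega) _ (ih fun i hi => hs i (by omega))

namespace LoopProg

/-- The translation into a program with while loops. -/
def toProg : LoopProg → Prog
  | skip => .skip
  | set r e => .set r e
  | store a i e => .store a i e
  | print e => .print e
  | seq P Q => .seq P.toProg Q.toProg
  | ite e P Q => .ite e P.toProg Q.toProg
  | loop r P => .seq (.set r (.const 0)) (.while (.lt (.reg r) (.reg 2))
      (.seq P.toProg (.set r (.add (.reg r) (.const 1)))))

/-- The final state, when register `2` holds `n`. -/
def run (n : ℕ) : LoopProg → State → State
  | skip, s => s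
  | set r e, s => s.setReg r (e.eval s)
  | store a i e, s => s.setCell a (i.eval s) (e.eval s)
  | print e, s => s.emit (decide (e.eval s ≠ 0))
  | seq P Q, s => Q.run n (P.run n s)
  | ite e P Q, s => if e.eval s ≠ 0 then P.run n s else Q.run n s
  | loop r P, s => (iterUpTo (fun i s => P.run n (s.setReg r i)) n s).setReg r n

/-- The program may write into register `q`. -/
def Writes (q : ℕ) : LoopProg → Prop
  | set r _ => r = q
  | seq P Q => P.Writes q ∨ Q.Writes q
  | ite _ P Q => P.Writes q ∨ Q.Writes q
  | loop r P => r = q ∨ P.Writes q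
  | _ => False

/-- Loop counters are not written in the loop body, and register `2` is never written. -/
def Wf : LoopProg → Prop
  | set r _ => r ≠ 2
  | seq P Q => P.Wf ∧ Q.Wf
  | ite _ P Q => P.Wf ∧ Q.Wf
  | loop r P => r ≠ 2 ∧ ¬ P.Writes r ∧ P.Wf
  | _ => True

/-- A bound for the running time in terms of the content of register `2`. -/
noncomputable def time : LoopProg → Polynomial ℕ
  | skip => 1
  | set _ e => (e.cost + 1 : ℕ)
  | store _ i e => (i.cost + e.cost + 1 : ℕ)
  | print e => (e.cost + 1 : ℕ)
  | seq P Q => P.time + Q.time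
  | ite e P Q => (e.cost + 1 : ℕ) + (P.time + Q.time)
  | loop _ P => .X * (P.time + (8 : ℕ)) + (6 : ℕ)

theorem run_reg_of_not_writes {n q : ℕ} {P : LoopProg} (h : ¬ P.Writes q) (s : State) :
    (P.run n s).reg q = s.reg q := by
  induction P generalizing s with
  | skip | store | print => rfl
  | set r e => simp only [Writes] at h; simp [run, State.setReg, Function.update_of_ne (Ne.symm h)]
  | seq P Q ihP ihQ =>
    simp only [Writes, not_or] at h
    rw [run, ihQ h.2, ihP h.1]
  | ite e P Q ihP ihQ =>
    simp only [Writes, not_or] at h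
    rw [run]; split_ifs
    exacts [ihP h.1 s, ihQ h.2 s]
  | loop r P ih =>
    simp only [Writes, not_or] at h
    have : (iterUpTo (fun i s => P.run n (s.setReg r i)) n s).reg q = s.reg q := by
      refine iterUpTo_induction (fun _ (s' : State) => s'.reg q = s.reg q) rfl fun i _ b hb => ?_
      rw [ih h.2, ← hb]; simp [State.setReg, Function.update_of_ne (Ne.symm h.1)]
    rw [run, ← this]; simp [State.setReg, Function.update_of_ne (Ne.symm h.1)]

theorem Wf.not_writes {P : LoopProg} (h : P.Wf) : ¬ P.Writes 2 := by
  induction P with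
  | skip | store | print => exact id
  | set r e => exact h
  | seq P Q ihP ihQ => exact not_or.2 ⟨ihP h.1, ihQ h.2⟩
  | ite e P Q ihP ihQ => exact not_or.2 ⟨ihP h.1, ihQ h.2⟩
  | loop r P ih => exact not_or.2 ⟨h.1, ih h.2.2⟩

/-- Induction on the number `k` of rounds still to run. A round costs 4 for the guard and 4 for the
increment besides the body, and the final failing guard costs 4. As the body keeps the counter, the
increment really produces `i + 1`. -/
theorem exec_while_iterUpTo {P : Prog} {r n T : ℕ} {f : State → State} (hr : r ≠ 2)
    (hP : ∀ s, s.reg 2 = n → ∃ t ≤ T, Exec P s (f s) t)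
    (h2 : ∀ s, (f s).reg 2 = s.reg 2) (hf : ∀ s, (f s).reg r = s.reg r)
    (k i : ℕ) (hk : i + k = n) (s : State) (hs : s.reg 2 = n) :
    ∃ t ≤ k * (T + 8) + 4, Exec (.while (.lt (.reg r) (.reg 2))
      (.seq P (.set r (.add (.reg r) (.const 1)))))
      ((iterUpTo (fun i s => f (s.setReg r i)) i s).setReg r i)
      ((iterUpTo (fun i s => f (s.setReg r i)) n s).setReg r n) t := by
  have key : ∀ i, (iterUpTo (fun i s => f (s.setReg r i)) i s).reg 2 = n := fun i => by
    refine iterUpTo_induction (fun _ (s' : State) => s'.reg 2 = n) hs fun i _ b hb => ?_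
    rw [h2]; simpa [State.setReg, Function.update_of_ne hr.symm] using hb
  have key' : ∀ i x, ((iterUpTo (fun i s => f (s.setReg r i)) i s).setReg r x).reg 2 = n :=
    fun i x => by simpa [State.setReg, Function.update_of_ne hr.symm] using key i
  induction k generalizing i with
  | zero =>
    obtain rfl : i = n := by omega
    refine ⟨_, ?_, Exec.while_false ?_⟩
    · simp [Expr.cost]
    · simp only [Expr.eval, key']; simp [State.setReg]
  | succ k ih =>
    obtain ⟨t, ht, h⟩ := ih (i + 1) (by omega)
    obtain ⟨t', ht', h'⟩ := hP _ (key' i i)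
    refine ⟨4 + (t' + 4) + t, ?_, Exec.while_true ?_ (Exec.seq h' (Exec.set _ _ _)) ?_⟩
    · grind
    · simp only [Expr.eval, key']; simp [State.setReg]; omega
    · have he : (f ((iterUpTo (fun i s => f (s.setReg r i)) i s).setReg r i)).reg r = i := by
        rw [hf]; simp [State.setReg]
      rw [show Expr.eval _ (.add (.reg r) (.const 1)) = i + 1 from congrArg (· + 1) he]
      exact h

theorem exec_toProg {P : LoopProg} (hP : P.Wf) {n : ℕ} (s : State) (hs : s.reg 2 = n) :
    ∃ t ≤ P.time.eval n, Exec P.toProg s (P.run n s) t := by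
  induction P generalizing s with
  | skip => exact ⟨1, by simp [time], .skip s⟩
  | set r e => exact ⟨_, by simp [time], .set r e s⟩
  | store a i e => exact ⟨_, by simp [time], .store a i e s⟩
  | print e => exact ⟨_, by simp [time], .print e s⟩
  | seq P Q ihP ihQ =>
    obtain ⟨t, ht, h⟩ := ihP hP.1 s hs
    obtain ⟨t', ht', h'⟩ := ihQ hP.2 (P.run n s)
      (by rw [run_reg_of_not_writes hP.1.not_writes, hs])
    exact ⟨t + t', by simp only [time, Polynomial.eval_add]; omega, .seq h h'⟩
  | ite e P Q ihP ihQ =>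
    obtain ⟨t, ht, h⟩ := ihP hP.1 s hs
    obtain ⟨t', ht', h'⟩ := ihQ hP.2 s hs
    by_cases he : e.eval s = 0
    · refine ⟨e.cost + 1 + t', ?_, .ite_false he ?_⟩
      · simp only [time, Polynomial.eval_add, Polynomial.eval_natCast, Nat.cast_id]; omega
      · simpa [run, he] using h'
    · refine ⟨e.cost + 1 + t, ?_, .ite_true he ?_⟩
      · simp only [time, Polynomial.eval_add, Polynomial.eval_natCast, Nat.cast_id]; omega
      · simpa [run, he] using h
  | loop r P ih =>
    obtain ⟨t, ht, h⟩ := exec_while_iterUpTo (f := P.run n) hP.1 (fun s hs => ih hP.2.2 s hs)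
      (fun s => run_reg_of_not_writes hP.2.2.not_writes s)
      (fun s => run_reg_of_not_writes hP.2.1 s) n 0 (by omega) s hs
    refine ⟨2 + t, ?_, .seq (.set r (.const 0) s) h⟩
    simp only [time, Polynomial.eval_add, Polynomial.eval_mul, Polynomial.eval_X,
      Polynomial.eval_natCast, Nat.cast_id]
    omega

end LoopProg

/-! ### Bounded first-order formulas and programs that evaluate them -/

/-- The states agree except, possibly, on the registers from `d` on. -/
def State.Agree (d : ℕ) (s s' : State) : Prop :=
  (∀ r < d, s'.reg r = s.reg r) ∧ s'.arr = s.arr ∧ s'.out = s.out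

namespace State.Agree

theorem trans {d : ℕ} {s s' s'' : State} (h : s.Agree d s') (h' : s'.Agree d s'') :
    s.Agree d s'' :=
  ⟨fun r hr => (h'.1 r hr).trans (h.1 r hr), h'.2.1.trans h.2.1, h'.2.2.trans h.2.2⟩

theorem mono {d d' : ℕ} (hd : d ≤ d') {s s' : State} (h : s.Agree d' s') : s.Agree d s' :=
  ⟨fun r hr => h.1 r (by omega), h.2⟩

theorem setReg {d r : ℕ} (hr : d ≤ r) (s : State) (x : ℕ) : s.Agree d (s.setReg r x) :=
  ⟨fun q hq => by simp [State.setReg, Function.update_of_ne (show q ≠ r by omega)], rfl, rfl⟩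

end State.Agree

/-- The states agree on the arrays and on the registers with an even number below `d`. -/
def State.SameVars (d : ℕ) (s s' : State) : Prop :=
  (∀ r < d, r % 2 = 0 → s'.reg r = s.reg r) ∧ s'.arr = s.arr

theorem State.Agree.sameVars {d : ℕ} {s s' : State} (h : s.Agree d s') : s.SameVars d s' :=
  ⟨fun r hr _ => h.1 r hr, h.2.1⟩

/-- Odd registers are scratch space (the flags of `Form.ex`) and are exempt from the agreement, so
passing from `d` to `d + 2` is harmless when `d` is even. Every use has even `d` and discards the
second alternative. -/
theorem State.SameVars.setReg {d : ℕ} {s s' : State} (h : s.SameVars d s') (x : ℕ) :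
    (s.setReg d x).SameVars (d + 2) (s'.setReg d x) ∨ d % 2 = 1 := by
  by_cases hd : d % 2 = 1
  · exact .inr hd
  refine .inl ⟨fun r hr he => ?_, h.2⟩
  by_cases hrd : r = d
  · simp [State.setReg, hrd]
  · simpa [State.setReg, Function.update_of_ne hrd] using h.1 r (by omega) he

/-- Every register in the expression has an even number below `d`. -/
def Expr.regsBelow (d : ℕ) : Expr → Bool
  | const _ => true
  | reg r => decide (r < d) && decide (r % 2 = 0)
  | cell _ e => e.regsBelow d
  | add e₁ e₂ | sub e₁ e₂ | lt e₁ e₂ | eq e₁ e₂ => e₁.regsBelow d && e₂.regsBelow d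

theorem Expr.eval_congr {d : ℕ} {e : Expr} (he : e.regsBelow d) {s s' : State}
    (h : s.SameVars d s') : e.eval s' = e.eval s := by
  induction e with
  | const => rfl
  | reg r =>
    simp only [regsBelow, Bool.and_eq_true, decide_eq_true_eq] at he
    exact h.1 r he.1 he.2
  | cell a e ih => simp only [eval, ih he, h.2]
  | add e₁ e₂ ih₁ ih₂ | sub e₁ e₂ ih₁ ih₂ | lt e₁ e₂ ih₁ ih₂ | eq e₁ e₂ ih₁ ih₂ =>
    simp only [regsBelow, Bool.and_eq_true] at he
    simp only [eval, ih₁ he.1, ih₂ he.2]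

/-- First-order formulas about the memory, with quantifiers bounded by register `2`. At level `d`
the quantified variable is register `d`, and its scope is at level `d + 2`; variables are registers
with an even number. -/
inductive Form : Type
  | test (e : Expr)
  | neg (φ : Form)
  | and (φ ψ : Form)
  | ex (φ : Form)

namespace Form

/-- Truth at level `d`. -/
def Holds (n : ℕ) : Form → ℕ → State → Prop
  | test e, _, s => e.eval s ≠ 0
  | neg φ, d, s => ¬ φ.Holds n d s
  | and φ ψ, d, s => φ.Holds n d s ∧ ψ.Holds n d s
  | ex φ, d, s => ∃ i : Fin n, φ.Holds n (d + 2) (s.setReg d i)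

/-- The formula refers only to variables below `d` and to its bound variables. -/
def wellScoped : Form → ℕ → Bool
  | test e, d => e.regsBelow d
  | neg φ, d => φ.wellScoped d
  | and φ ψ, d => φ.wellScoped d && ψ.wellScoped d
  | ex φ, d => decide (d % 2 = 0) && φ.wellScoped (d + 2)

/-- A program that writes the truth value into register `d` and keeps all registers below. -/
def prog : Form → ℕ → LoopProg
  | test e, d => .set d e
  | neg φ, d => .seq (φ.prog d) (.set d (.eq (.reg d) (.const 0)))
  | and φ ψ, d => .seq (φ.prog d) (.ite (.reg d) (ψ.prog d) .skip)
  | ex φ, d => .seq (.set (d + 1) (.const 0)) (.seq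
      (.loop d (.seq (φ.prog (d + 2)) (.ite (.reg (d + 2)) (.set (d + 1) (.const 1)) .skip)))
      (.set d (.reg (d + 1))))

theorem not_writes_prog {φ : Form} {d q : ℕ} (hq : q < d) : ¬ (φ.prog d).Writes q := by
  induction φ generalizing d with
  | test e => simp [prog, LoopProg.Writes]; omega
  | neg φ ih => simp [prog, LoopProg.Writes, ih hq]; omega
  | and φ ψ ih ih' => simp [prog, LoopProg.Writes, ih hq, ih' hq]
  | ex φ ih => simp [prog, LoopProg.Writes, ih (show q < d + 2 by omega)]; omega

theorem prog_wf {φ : Form} {d : ℕ} (hd : 2 < d) : (φ.prog d).Wf := by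
  induction φ generalizing d with
  | test e => simp [prog, LoopProg.Wf]; omega
  | neg φ ih => simp [prog, LoopProg.Wf, ih hd]; omega
  | and φ ψ ih ih' => simp [prog, LoopProg.Wf, ih hd, ih' hd]
  | ex φ ih =>
    simp [prog, LoopProg.Wf, LoopProg.Writes, ih (show 2 < d + 2 by omega),
      not_writes_prog (φ := φ) (show d < d + 2 by omega)]
    omega

theorem holds_congr {n : ℕ} {φ : Form} {d : ℕ} (hφ : φ.wellScoped d) {s s' : State}
    (h : s.SameVars d s') : φ.Holds n d s' ↔ φ.Holds n d s := by
  induction φ generalizing d s s' with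
  | test e => simp only [Holds, Expr.eval_congr hφ h]
  | neg φ ih => simp only [Holds, ih hφ h]
  | and φ ψ ih ih' =>
    simp only [wellScoped, Bool.and_eq_true] at hφ
    simp only [Holds, ih hφ.1 h, ih' hφ.2 h]
  | ex φ ih =>
    simp only [wellScoped, Bool.and_eq_true, decide_eq_true_eq] at hφ
    exact exists_congr fun i => ih hφ.2 ((h.setReg i).resolve_right (by omega))

/-- A quantifier becomes a loop over register `d` that raises the flag in register `d + 1` once a
witness is met; the subformula works from register `d + 2` on, so it disturbs neither. -/
theorem run_prog {n : ℕ} {φ : Form} {d : ℕ} (hφ : φ.wellScoped d) (s : State) :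
    s.Agree d ((φ.prog d).run n s) ∧ (((φ.prog d).run n s).reg d ≠ 0 ↔ φ.Holds n d s) := by
  induction φ generalizing d s with
  | test e =>
    exact ⟨.setReg le_rfl _ _, by simp [prog, LoopProg.run, State.setReg, Holds]⟩
  | neg φ ih =>
    obtain ⟨h, h'⟩ := ih hφ s
    refine ⟨h.trans (.setReg le_rfl _ _), ?_⟩
    rw [Holds, ← h', not_not]
    simp only [prog, LoopProg.run, State.setReg, Expr.eval, Function.update_self]
    split_ifs with h0 <;> simp [h0]
  | and φ ψ ih ih' =>
    simp only [wellScoped, Bool.and_eq_true] at hφ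
    obtain ⟨h, h'⟩ := ih hφ.1 s
    obtain ⟨k, k'⟩ := ih' hφ.2 ((φ.prog d).run n s)
    rw [holds_congr hφ.2 h.sameVars] at k'
    rw [Holds, ← h', ← k']
    by_cases h0 : ((φ.prog d).run n s).reg d = 0
    · simp [prog, LoopProg.run, Expr.eval, h0, h]
    · simp [prog, LoopProg.run, Expr.eval, h0, h.trans k]
  | ex φ ih =>
    simp only [wellScoped, Bool.and_eq_true, decide_eq_true_eq] at hφ
    set B : LoopProg :=
      .seq (φ.prog (d + 2)) (.ite (.reg (d + 2)) (.set (d + 1) (.const 1)) .skip) with hB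
    -- Invariant: the flag is nonzero iff one of the first `i` values is a witness. Truth is always
    -- referred back to the initial `s`, which `holds_congr` allows.
    have key := iterUpTo_induction (f := fun i s => B.run n (s.setReg d i)) (n := n)
      (a := s.setReg (d + 1) 0)
      (fun i s' => i ≤ n → s.Agree d s' ∧
        (s'.reg (d + 1) ≠ 0 ↔ ∃ j : Fin n, j < i ∧ φ.Holds n (d + 2) (s.setReg d j)))
      (fun _ => ⟨.setReg (by omega) _ _, by simp [State.setReg]⟩)
      (fun i hi b hb _ => by
        obtain ⟨hb, hb'⟩ := hb (by omega)
        obtain ⟨h, h'⟩ := ih hφ.2 (b.setReg d i)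
        rw [holds_congr hφ.2 ((hb.sameVars.setReg i).resolve_right (by omega))] at h'
        have hd1 : (((φ.prog (d + 2)).run n (b.setReg d i))).reg (d + 1) = b.reg (d + 1) := by
          rw [h.1 _ (by omega)]; simp [State.setReg]
        have hag := (hb.trans (.setReg le_rfl b i)).trans (h.mono (by omega : d ≤ d + 2))
        have hex : (∃ j : Fin n, j < i + 1 ∧ φ.Holds n (d + 2) (s.setReg d j)) ↔
            (∃ j : Fin n, j < i ∧ φ.Holds n (d + 2) (s.setReg d j)) ∨
              φ.Holds n (d + 2) (s.setReg d i) := by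
          constructor
          · rintro ⟨j, hj, hj'⟩
            rcases Nat.lt_succ_iff_lt_or_eq.1 hj with hj | hj
            · exact .inl ⟨j, hj, hj'⟩
            · exact .inr (hj ▸ hj')
          · rintro (⟨j, hj, hj'⟩ | h)
            · exact ⟨j, by omega, hj'⟩
            · exact ⟨⟨i, hi⟩, by simp, h⟩
        rw [hex, ← hb', ← h']
        by_cases h0 : ((φ.prog (d + 2)).run n (b.setReg d i)).reg (d + 2) = 0
        · simp [hB, LoopProg.run, Expr.eval, h0, hag, hd1]
        · simp only [hB, LoopProg.run]
          rw [if_pos (show Expr.eval _ (.reg (d + 2)) ≠ 0 from h0)]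
          refine ⟨hag.trans (.setReg (by omega) _ _), ?_⟩
          exact iff_of_true (by simp [State.setReg, Expr.eval]) (.inr h0))
    obtain ⟨k, k'⟩ := key le_rfl
    refine ⟨(k.trans (.setReg le_rfl _ n)).trans (.setReg le_rfl _ _), ?_⟩
    have : (Holds n (ex φ) d s) ↔
        ∃ j : Fin n, j < n ∧ φ.Holds n (d + 2) (s.setReg d j) := by simp [Holds]
    rw [this, ← k']
    simp [prog, LoopProg.run, State.setReg, Expr.eval, ← hB]

/-- Disjunction. -/
def or (φ ψ : Form) : Form := neg (and (neg φ) (neg ψ))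

@[simp] theorem holds_or {n d : ℕ} {φ ψ : Form} {s : State} :
    (or φ ψ).Holds n d s ↔ φ.Holds n d s ∨ ψ.Holds n d s := by
  simp [or, Holds]; tauto

/-- A program that branches according to a formula at level `d`. -/
def branch (d : ℕ) (φ : Form) (P Q : LoopProg) : LoopProg :=
  .seq (φ.prog d) (.ite (.reg d) P Q)

theorem run_branch {n d : ℕ} {φ : Form} (hφ : φ.wellScoped d) (P Q : LoopProg) (s : State) :
    ∃ s', s.Agree d s' ∧ (φ.Holds n d s → (φ.branch d P Q).run n s = P.run n s') ∧
      (¬ φ.Holds n d s → (φ.branch d P Q).run n s = Q.run n s') := by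
  obtain ⟨h, h'⟩ := run_prog (n := n) hφ s
  refine ⟨_, h, fun H => ?_, fun H => ?_⟩ <;> rw [← h'] at H <;>
    simp only [branch, LoopProg.run, Expr.eval] <;> simp [H]

/-- A program that prints the truth value of a formula at level `d`. -/
def printTruth (d : ℕ) (φ : Form) : LoopProg := .seq (φ.prog d) (.print (.reg d))

open Classical in
theorem run_printTruth {n d : ℕ} {φ : Form} (hφ : φ.wellScoped d) (s : State) :
    ∃ s', s.Agree d s' ∧ (φ.printTruth d).run n s = s'.emit (decide (φ.Holds n d s)) := by
  obtain ⟨h, h'⟩ := run_prog (n := n) hφ s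
  refine ⟨_, h, ?_⟩
  simp only [printTruth, LoopProg.run, Expr.eval]
  congr 1
  exact decide_eq_decide.2 h'

end Form

end RAM

/-! ### Simplicial vertices, representatives and uncovered edges -/

namespace SimpleGraph

section Simplicial

variable {V : Type*} (G : SimpleGraph V)

/-- The neighbours of `v` are pairwise adjacent. -/
def IsSimplicial (v : V) : Prop := ∀ u w, G.Adj v u → G.Adj v w → u ≠ w → G.Adj u w

/-- `u` lies in the closed neighbourhood of `v`. -/
def InClosedNhd (v u : V) : Prop := u = v ∨ G.Adj v u

/-- `v` is the least simplicial vertex in its closed neighbourhood. -/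
def IsRep [LT V] (v : V) : Prop :=
  G.IsSimplicial v ∧ ¬ ∃ u, u < v ∧ G.IsSimplicial u ∧ G.Adj u v

/-- The edge `uw` lies in no closed neighbourhood of a simplicial vertex. -/
def Uncovered [LT V] (u w : V) : Prop :=
  G.Adj u w ∧ ¬ ∃ v, G.IsRep v ∧ G.InClosedNhd v u ∧ G.InClosedNhd v w

/-- `u` is an endpoint of an uncovered edge. -/
def IsEnd [LT V] (u : V) : Prop := ∃ w, G.Uncovered u w

/-- Two distinct non-adjacent endpoints of uncovered edges. -/
def Conflict [LT V] (u w : V) : Prop := G.IsEnd u ∧ G.IsEnd w ∧ u ≠ w ∧ ¬ G.Adj u w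

/-- `u` is in conflict with another vertex. -/
def InConflict [LT V] (u : V) : Prop := ∃ w, G.Conflict u w

/-- An uncovered edge between two vertices that are in conflicts. -/
def Linked [LT V] (u w : V) : Prop := G.Uncovered u w ∧ G.InConflict u ∧ G.InConflict w

/-- `v` lies in no closed neighbourhood of a simplicial vertex. -/
def IsFree [LT V] (v : V) : Prop := ¬ ∃ r, G.IsRep r ∧ G.InClosedNhd r v

variable {G}

theorem InClosedNhd.refl (v : V) : G.InClosedNhd v v := .inl rfl

/-- The closed neighbourhood of `u` is a clique containing `v`. Used in both directions, this makes
adjacent simplicial vertices twins. -/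
theorem IsSimplicial.inClosedNhd_of_adj {u v w : V} (hu : G.IsSimplicial u) (huv : G.Adj u v)
    (hw : G.InClosedNhd u w) : G.InClosedNhd v w := by
  rcases hw with rfl | hw
  · exact .inr huv.symm
  · by_cases h : w = v
    · exact .inl h
    · exact .inr (hu v w huv hw (Ne.symm h))

theorem IsSimplicial.isClique {v : V} (hv : G.IsSimplicial v) :
    G.IsClique {u | G.InClosedNhd v u} := by
  rintro u (rfl | hu) w (rfl | hw) h
  · exact absurd rfl h
  · exact hw
  · exact hu.symm
  · exact hv u w hu hw h

theorem Uncovered.symm [LT V] {u w : V} (h : G.Uncovered u w) : G.Uncovered w u :=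
  ⟨h.1.symm, fun ⟨v, hv, h₁, h₂⟩ => h.2 ⟨v, hv, h₂, h₁⟩⟩

theorem Conflict.symm [LT V] {u w : V} (h : G.Conflict u w) : G.Conflict w u :=
  ⟨h.2.1, h.1, h.2.2.1.symm, fun h' => h.2.2.2 h'.symm⟩

theorem Linked.symm [LT V] {u w : V} (h : G.Linked u w) : G.Linked w u :=
  ⟨h.1.symm, h.2.2, h.2.1⟩

/-- Every simplicial vertex has the same closed neighbourhood as a representative. -/
theorem IsSimplicial.exists_isRep [LinearOrder V] [Finite V] {v : V} (hv : G.IsSimplicial v) :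
    ∃ r, G.IsRep r ∧ ∀ w, G.InClosedNhd r w ↔ G.InClosedNhd v w := by
  have hne : {u | G.IsSimplicial u ∧ G.InClosedNhd v u}.Nonempty := ⟨v, hv, .refl v⟩
  obtain ⟨r, ⟨hr, hvr⟩, hmin⟩ := (Set.toFinite _).exists_minimal hne
  have heq : ∀ w, G.InClosedNhd r w ↔ G.InClosedNhd v w := by
    rcases hvr with rfl | h
    · exact fun _ => .rfl
    · exact fun w => ⟨hr.inClosedNhd_of_adj h.symm, hv.inClosedNhd_of_adj h⟩
  refine ⟨r, ⟨hr, fun ⟨u, hur, hu, ha⟩ => ?_⟩, heq⟩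
  exact absurd (hmin ⟨hu, (heq u).1 (.inr ha.symm)⟩ hur.le) hur.not_ge

/-- The larger of two adjacent simplicial vertices is not least in its closed neighbourhood. -/
theorem IsRep.not_adj [LinearOrder V] {u v : V} (hu : G.IsRep u) (hv : G.IsRep v) :
    ¬ G.Adj u v := by
  intro h
  rcases lt_trichotomy u v with h' | rfl | h'
  · exact hv.2 ⟨u, h', hu.1, h⟩
  · exact h.ne rfl
  · exact hu.2 ⟨v, h', hv.1, h.symm⟩

end Simplicial

/-! ### Counting cliques through an independent set; two cliques as a 2-colouring -/

section Cover

variable {V : Type*} [LinearOrder V] {G : SimpleGraph V}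

open Classical in
/-- A vertex that lies in only one clique of an edge clique cover is simplicial. -/
theorem IsEdgeCliqueCover.isSimplicial {𝒦 : Finset (Finset V)} (h𝒦 : G.IsEdgeCliqueCover 𝒦)
    {v : V} (hv : ({K ∈ 𝒦 | v ∈ K} : Finset (Finset V)).card ≤ 1) : G.IsSimplicial v := by
  intro u w hu hw hne
  obtain ⟨K, hK, hvK, huK⟩ := h𝒦.2 v u hu
  obtain ⟨L, hL, hvL, hwL⟩ := h𝒦.2 v w hw
  have : K = L := Finset.card_le_one.1 hv K (by simp [*]) L (by simp [*])
  subst this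
  exact h𝒦.1 K hK huK hwL hne

open Classical in
-- A clique contains at most one vertex of `I`, so the families of cliques through different
-- vertices of `I` are disjoint.
theorem IsEdgeCliqueCover.sum_card_filter_le {𝒦 : Finset (Finset V)}
    (h𝒦 : G.IsEdgeCliqueCover 𝒦) {I : Finset V} (hI : G.IsIndepSet I) :
    ∑ v ∈ I, ({K ∈ 𝒦 | v ∈ K} : Finset (Finset V)).card ≤ 𝒦.card := by
  rw [← Finset.card_biUnion]
  · exact Finset.card_le_card (Finset.biUnion_subset.2 fun v _ => Finset.filter_subset _ _)
  · intro v hv w hw hne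
    refine Finset.disjoint_left.2 fun K hK hK' => hI hv hw hne ?_
    rw [Finset.mem_filter] at hK hK'
    exact h𝒦.1 K hK.1 hK.2 hK'.2 hne

open Classical in
theorem IsEdgeCliqueCover.one_le_card_filter (hG : ∀ v, ¬ G.IsIsolated v)
    {𝒦 : Finset (Finset V)} (h𝒦 : G.IsEdgeCliqueCover 𝒦) (v : V) :
    1 ≤ ({K ∈ 𝒦 | v ∈ K} : Finset (Finset V)).card := by
  obtain ⟨u, hu⟩ := exists_adj_iff_not_isIsolated.2 (hG v)
  obtain ⟨K, hK, hv, -⟩ := h𝒦.2 v u hu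
  exact Finset.card_pos.2 ⟨K, by simp [*]⟩

/-- A colouring of the vertices in conflicts with colours `1` and `2` that is compatible with the
conflicts and links. -/
def IsGoodColoring (G : SimpleGraph V) (c : V → ℕ) : Prop :=
  (∀ v, c v = 1 ∨ c v = 2) ∧ (∀ u w, G.Linked u w → c u = c w) ∧
    ∀ u w, G.Conflict u w → c u ≠ c w

/-- `u` belongs to the clique of colour `i`. -/
def InColorClass (G : SimpleGraph V) (c : V → ℕ) (i : ℕ) (u : V) : Prop :=
  G.IsEnd u ∧ (¬ G.InConflict u ∨ c u = i)

/-- Two non-adjacent members would be in conflict with each other, so both would have colour `i`,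
against the conflict condition. -/
theorem IsGoodColoring.isClique {c : V → ℕ} (hc : G.IsGoodColoring c) (i : ℕ) :
    G.IsClique {u | G.InColorClass c i u} := by
  intro u hu w hw hne
  by_contra ha
  have hcf : G.Conflict u w := ⟨hu.1, hw.1, hne, ha⟩
  exact hc.2.2 u w hcf ((hu.2.resolve_left (not_not.2 ⟨w, hcf⟩)).trans
    (hw.2.resolve_left (not_not.2 ⟨u, hcf.symm⟩)).symm)

/-- An endpoint without conflicts belongs to both classes, so only two endpoints in conflicts could
be separated; these are linked and hence share a colour. -/
theorem IsGoodColoring.exists_inColorClass {c : V → ℕ} (hc : G.IsGoodColoring c) {u w : V}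
    (h : G.Uncovered u w) :
    (G.InColorClass c 1 u ∧ G.InColorClass c 1 w) ∨
      (G.InColorClass c 2 u ∧ G.InColorClass c 2 w) := by
  have hu : G.IsEnd u := ⟨w, h⟩
  have hw : G.IsEnd w := ⟨u, h.symm⟩
  have h1 := hc.1 u
  have h2 := hc.1 w
  have h3 := hc.2.1 u w
  simp only [InColorClass, hu, hw, true_and]
  by_cases hcu : G.InConflict u <;> by_cases hcw : G.InConflict w <;>
    simp only [hcu, hcw, not_true, not_false_iff, true_or, true_and, false_or, and_true, or_self]
  · rw [← h3 ⟨h, hcu, hcw⟩]; simpa using h1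
  · exact h1
  · exact h2

/-- An endpoint `u` in conflict lies in exactly one of `K`, `L`: its conflict partner lies in one of
them and cannot share it with `u`. Membership in `K` is therefore a faithful colour. -/
theorem isGoodColoring_of_cover {K L : Finset V} (hK : G.IsClique (K : Set V))
    (hL : G.IsClique (L : Set V))
    (h : ∀ u w, G.Uncovered u w → (u ∈ K ∧ w ∈ K) ∨ (u ∈ L ∧ w ∈ L)) :
    G.IsGoodColoring fun v => if v ∈ K then 1 else 2 := by
  have hend : ∀ u, G.IsEnd u → u ∈ K ∨ u ∈ L := fun u ⟨w, hw⟩ =>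
    (h u w hw).imp And.left And.left
  have hcf : ∀ u, G.InConflict u → ¬ (u ∈ K ∧ u ∈ L) := by
    rintro u ⟨w, -, hw, hne, ha⟩ ⟨huK, huL⟩
    rcases hend w hw with hw | hw
    exacts [ha (hK huK hw hne), ha (hL huL hw hne)]
  refine ⟨fun v => by by_cases hv : v ∈ K <;> simp [hv], fun u w hl => ?_, fun u w hl he => ?_⟩
  · have h1 := hcf u hl.2.1
    have h2 := hcf w hl.2.2
    have h3 := h u w hl.1
    simp only
    split_ifs <;> tauto
  · have h1 := hend u hl.1
    have h2 := hend w hl.2.1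
    have h3 : ¬ (u ∈ K ∧ w ∈ K) := fun h => hl.2.2.2 (hK h.1 h.2 hl.2.2.1)
    have h4 : ¬ (u ∈ L ∧ w ∈ L) := fun h => hl.2.2.2 (hL h.1 h.2 hl.2.2.1)
    revert he
    simp only
    split_ifs <;> simp <;> tauto

end Cover

/-- The default `a₀` pads sets with fewer than two elements; for families of cliques it will be the
empty clique. -/
theorem exists_eq_pair_of_card_le_two {α : Type*} {s : Finset α} (hs : s.card ≤ 2) (a₀ : α) :
    ∃ a b : α, (∀ x ∈ s, x = a ∨ x = b) ∧ (a ∈ s ∨ a = a₀) ∧ (b ∈ s ∨ b = a₀) := by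
  classical
  interval_cases h : s.card
  · exact ⟨a₀, a₀, by simp [Finset.card_eq_zero.1 h]⟩
  · obtain ⟨a, rfl⟩ := Finset.card_eq_one.1 h
    exact ⟨a, a, by simp⟩
  · obtain ⟨a, b, -, rfl⟩ := Finset.card_eq_two.1 h
    exact ⟨a, b, by simp⟩

/-! ### The number of representatives against the independence number -/

section Count

variable {V : Type*} [LinearOrder V] [Fintype V] (G : SimpleGraph V)

open Classical in
/-- The set of representatives. -/
noncomputable def reps : Finset V := {v | G.IsRep v}

variable {G}

@[simp] theorem mem_reps {v : V} : v ∈ G.reps ↔ G.IsRep v := by simp [reps]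

theorem card_reps_le_indepNum : G.reps.card ≤ G.indepNum :=
  IsIndepSet.card_le_indepNum fun u hu v hv _ =>
    IsRep.not_adj (mem_reps.1 (by simpa using hu)) (mem_reps.1 (by simpa using hv))

theorem IsFree.card_reps_lt_indepNum {v : V} (hv : G.IsFree v) : G.reps.card < G.indepNum := by
  have hv' : v ∉ G.reps := fun h => hv ⟨v, mem_reps.1 h, .refl v⟩
  rw [Nat.lt_iff_add_one_le, ← Finset.card_insert_of_notMem hv']
  refine IsIndepSet.card_le_indepNum ?_
  rw [Finset.coe_insert, IsIndepSet, Set.pairwise_insert]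
  refine ⟨fun u hu w hw _ => IsRep.not_adj (mem_reps.1 (by simpa using hu))
    (mem_reps.1 (by simpa using hw)), fun u hu _ => ?_⟩
  have h : ¬ G.Adj u v := fun h => hv ⟨u, mem_reps.1 (by simpa using hu), .inr h⟩
  exact ⟨fun h' => h h'.symm, h⟩

open Classical in
/-- In an edge clique cover, the cliques without representatives cover the uncovered edges. -/
theorem IsEdgeCliqueCover.exists_uncovered_cover (hG : ∀ v, ¬ G.IsIsolated v)
    {𝒦 : Finset (Finset V)} (h𝒦 : G.IsEdgeCliqueCover 𝒦) :
    ∃ 𝒦' ⊆ 𝒦, 𝒦'.card + G.reps.card ≤ 𝒦.card ∧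
      ∀ u w, G.Uncovered u w → ∃ K ∈ 𝒦', u ∈ K ∧ w ∈ K := by
  refine ⟨{K ∈ 𝒦 | ∀ r ∈ K, ¬ G.IsRep r}, Finset.filter_subset _ _, ?_, fun u w h => ?_⟩
  · rw [← Finset.card_filter_add_card_filter_not (s := 𝒦) (fun K => ∀ r ∈ K, ¬ G.IsRep r)]
    gcongr
    -- Each representative picks a clique through it; the choice is injective because
    -- representatives are pairwise non-adjacent.
    have : ∀ r, ∃ K ∈ 𝒦, r ∈ K := fun r => by
      obtain ⟨u, hu⟩ := exists_adj_iff_not_isIsolated.2 (hG r)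
      obtain ⟨K, hK, hr, -⟩ := h𝒦.2 r u hu
      exact ⟨K, hK, hr⟩
    choose f hf hf' using this
    refine Finset.card_le_card_of_injOn f (fun r hr => ?_) fun r hr r' hr' he => ?_
    · simp only [Finset.coe_filter, Set.mem_ofPred_eq, not_forall, not_not]
      exact ⟨hf r, r, hf' r, by simpa using hr⟩
    · by_contra hne
      exact IsRep.not_adj (by simpa using hr) (by simpa using hr')
        (h𝒦.1 _ (hf r) (hf' r) (by rw [he]; exact hf' r') hne)
  -- A clique through a representative lies in its closed neighbourhood, so it contains no uncovered
  -- edge.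
  · obtain ⟨K, hK, hu, hw⟩ := h𝒦.2 u w h.1
    refine ⟨K, Finset.mem_filter.2 ⟨hK, fun r hr hrep => h.2 ⟨r, hrep, ?_, ?_⟩⟩, hu, hw⟩
    · by_cases he : u = r
      exacts [.inl he, .inr (h𝒦.1 K hK hr hu (Ne.symm he))]
    · by_cases he : w = r
      exacts [.inl he, .inr (h𝒦.1 K hK hr hw (Ne.symm he))]

/-- The simplicial vertices of an independent set inject into the representatives. -/
theorem exists_injOn_reps {I : Finset V} (hI : G.IsIndepSet I) (hs : ∀ v ∈ I, G.IsSimplicial v) :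
    ∃ f : V → V, Set.InjOn f I ∧ ∀ v ∈ I, f v ∈ G.reps ∧
      ∀ w, G.InClosedNhd (f v) w ↔ G.InClosedNhd v w := by
  choose! f hf hf' using fun v (hv : G.IsSimplicial v) => hv.exists_isRep
  refine ⟨f, fun v hv w hw he => ?_, fun v hv => ⟨mem_reps.2 (hf v (hs v hv)), hf' v (hs v hv)⟩⟩
  by_contra hne
  have : G.InClosedNhd v w := by
    rw [← hf' v (hs v hv), he, hf' w (hs w hw)]; exact .refl w
  exact hI hv hw hne (this.resolve_left (Ne.symm hne))

/-- An edge clique cover with at most `α(G) + 1` cliques forces the number of representatives to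
be at least `α(G) - 1`, with a free vertex in case of equality. -/
theorem IsEdgeCliqueCover.indepNum_le (hG : ∀ v, ¬ G.IsIsolated v) {𝒦 : Finset (Finset V)}
    (h𝒦 : G.IsEdgeCliqueCover 𝒦) (hcard : 𝒦.card ≤ G.indepNum + 1) :
    G.indepNum ≤ G.reps.card ∨ (G.indepNum ≤ G.reps.card + 1 ∧ ∃ v, G.IsFree v) := by
  classical
  obtain ⟨I, hI, hIc⟩ := G.exists_isNIndepSet_indepNum
  have hsum := h𝒦.sum_card_filter_le hI
  by_cases hs : ∀ v ∈ I, G.IsSimplicial v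
  · obtain ⟨f, hf, hf'⟩ := exists_injOn_reps hI hs
    left
    rw [← hIc]
    exact Finset.card_le_card_of_injOn f (fun v hv => (hf' v hv).1) hf
  push Not at hs
  obtain ⟨v₀, hv₀, hns⟩ := hs
  -- A second non-simplicial vertex of `I` would make the sum at least 2 + 2 + (α - 2) = α + 2.
  have hsimp : ∀ v ∈ I.erase v₀, G.IsSimplicial v := by
    intro v hv
    by_contra hnv
    have h0 : 2 ≤ ({K ∈ 𝒦 | v₀ ∈ K} : Finset (Finset V)).card := by
      by_contra h; exact hns (h𝒦.isSimplicial (by omega))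
    have h1 : 2 ≤ ({K ∈ 𝒦 | v ∈ K} : Finset (Finset V)).card := by
      by_contra h; exact hnv (h𝒦.isSimplicial (by omega))
    rw [← Finset.add_sum_erase _ _ hv₀, ← Finset.add_sum_erase _ _ hv] at hsum
    have h2 := Finset.card_nsmul_le_sum ((I.erase v₀).erase v)
      (fun v => ({K ∈ 𝒦 | v ∈ K} : Finset (Finset V)).card) 1 fun v _ => h𝒦.one_le_card_filter hG v
    have h3 := Finset.card_erase_add_one hv₀
    have h4 := Finset.card_erase_add_one hv
    simp only [smul_eq_mul, mul_one] at h2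
    omega
  have hI' : G.IsIndepSet (I.erase v₀ : Finset V) :=
    hI.mono (by exact_mod_cast Finset.erase_subset _ _)
  obtain ⟨f, hf, hf'⟩ := exists_injOn_reps hI' hsimp
  have hle : (I.erase v₀).card ≤ G.reps.card :=
    Finset.card_le_card_of_injOn f (fun v hv => (hf' v hv).1) hf
  have h3 := Finset.card_erase_add_one hv₀
  by_cases hlt : G.indepNum ≤ G.reps.card
  · exact .inl hlt
  refine .inr ⟨by omega, v₀, fun ⟨r, hr, hrv⟩ => ?_⟩
  -- Now there are exactly α - 1 representatives, so `f` maps `I.erase v₀` onto them. Each of their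
  -- closed neighbourhoods is that of a vertex of `I` other than `v₀`, and so misses `v₀`.
  obtain ⟨v, hv, rfl⟩ := Finset.surj_on_of_inj_on_of_card_le (s := I.erase v₀) (t := G.reps)
    (fun v _ => f v) (fun v hv => (hf' v hv).1) (fun v w hv hw h => hf hv hw h) (by omega) r
    (mem_reps.2 hr)
  rw [(hf' v hv).2] at hrv
  have hne := Finset.ne_of_mem_erase hv
  exact hI (Finset.mem_of_mem_erase hv) hv₀ hne (hrv.resolve_left hne.symm)

/-- With only α cliques the counting leaves no room for a non-simplicial vertex in `I`. So there are
α representatives, which use up all cliques. -/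
theorem IsEdgeCliqueCover.not_uncovered (hG : ∀ v, ¬ G.IsIsolated v) {𝒦 : Finset (Finset V)}
    (h𝒦 : G.IsEdgeCliqueCover 𝒦) (hcard : 𝒦.card ≤ G.indepNum) (u w : V) :
    ¬ G.Uncovered u w := by
  classical
  intro huw
  obtain ⟨I, hI, hIc⟩ := G.exists_isNIndepSet_indepNum
  have hs : ∀ v ∈ I, G.IsSimplicial v := by
    intro v hv
    by_contra hnv
    have h1 : 2 ≤ ({K ∈ 𝒦 | v ∈ K} : Finset (Finset V)).card := by
      by_contra h; exact hnv (h𝒦.isSimplicial (by omega))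
    have hsum := h𝒦.sum_card_filter_le hI
    rw [← Finset.add_sum_erase _ _ hv] at hsum
    have h2 := Finset.card_nsmul_le_sum (I.erase v)
      (fun v => ({K ∈ 𝒦 | v ∈ K} : Finset (Finset V)).card) 1 fun v _ =>
        h𝒦.one_le_card_filter hG v
    have h3 := Finset.card_erase_add_one hv
    simp only [smul_eq_mul, mul_one] at h2
    omega
  obtain ⟨f, hf, hf'⟩ := exists_injOn_reps hI hs
  have hle : I.card ≤ G.reps.card :=
    Finset.card_le_card_of_injOn f (fun v hv => (hf' v hv).1) hf
  obtain ⟨𝒦', hsub, hc, hcov⟩ := h𝒦.exists_uncovered_cover hG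
  obtain ⟨K, hK, -⟩ := hcov u w huw
  have := Finset.card_pos.2 ⟨K, hK⟩
  omega

/-- At least α - 1 cliques go to representatives, so at most two remain for the uncovered edges. -/
theorem IsEdgeCliqueCover.exists_isGoodColoring (hG : ∀ v, ¬ G.IsIsolated v)
    {𝒦 : Finset (Finset V)} (h𝒦 : G.IsEdgeCliqueCover 𝒦) (hcard : 𝒦.card ≤ G.indepNum + 1) :
    ∃ c, G.IsGoodColoring c := by
  obtain ⟨𝒦', hsub, hc, hcov⟩ := h𝒦.exists_uncovered_cover hG
  have hle := h𝒦.indepNum_le hG hcard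
  obtain ⟨K, L, hKL, hK, hL⟩ :=
    exists_eq_pair_of_card_le_two (s := 𝒦') (by omega) (∅ : Finset V)
  have hcl : ∀ K, K ∈ 𝒦' ∨ K = ∅ → G.IsClique (K : Set V) := by
    rintro K (hK | rfl)
    exacts [h𝒦.1 K (hsub hK), by simp]
  refine ⟨_, isGoodColoring_of_cover (hcl K hK) (hcl L hL) fun u w h => ?_⟩
  obtain ⟨M, hM, hu, hw⟩ := hcov u w h
  rcases hKL M hM with rfl | rfl
  exacts [.inl ⟨hu, hw⟩, .inr ⟨hu, hw⟩]

/-- Without free vertices at least α cliques go to representatives, so a single clique must contain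
all endpoints of uncovered edges. -/
theorem IsEdgeCliqueCover.not_conflict (hG : ∀ v, ¬ G.IsIsolated v)
    {𝒦 : Finset (Finset V)} (h𝒦 : G.IsEdgeCliqueCover 𝒦) (hcard : 𝒦.card ≤ G.indepNum + 1)
    (hfree : ¬ ∃ v, G.IsFree v) (u w : V) : ¬ G.Conflict u w := by
  obtain ⟨𝒦', hsub, hc, hcov⟩ := h𝒦.exists_uncovered_cover hG
  have hle := (h𝒦.indepNum_le hG hcard).resolve_right fun h => hfree h.2
  rintro ⟨⟨u', hu⟩, ⟨w', hw⟩, hne, ha⟩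
  obtain ⟨K, hK, hu, -⟩ := hcov u u' hu
  obtain ⟨L, hL, hw, -⟩ := hcov w w' hw
  obtain rfl := Finset.card_le_one.1 (show 𝒦'.card ≤ 1 by omega) K hK L hL
  exact ha (h𝒦.1 K (hsub hK) hu hw hne)

end Count

end SimpleGraph

/-! ### Greedy 2-colouring by propagation -/

namespace SimpleGraph

section Coloring

variable {n : ℕ} (G : SimpleGraph (Fin n))

/-- The partial colouring `c` (with `0` for uncoloured vertices) forces the colour `i` for the
uncoloured vertex `w`; here `j` is the other colour. -/
def Forced (c : Fin n → ℕ) (i j : ℕ) (w : Fin n) : Prop :=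
  c w = 0 ∧ ∃ u, (c u = i ∧ G.Linked u w) ∨ (c u = j ∧ G.Conflict u w)

/-- The vertex `w` is uncoloured and no colour of any vertex is forced. -/
def Undetermined (c : Fin n → ℕ) (w : Fin n) : Prop :=
  c w = 0 ∧ ¬ ∃ v, G.Forced c 1 2 v ∨ G.Forced c 2 1 v

open Classical in
/-- Colour `w` if its colour is forced or arbitrary. -/
noncomputable def colorStep (w : Fin n) (c : Fin n → ℕ) : Fin n → ℕ :=
  if G.Forced c 1 2 w then Function.update c w 1
  else if G.Forced c 2 1 w then Function.update c w 2
  else if G.Undetermined c w then Function.update c w 1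
  else c

/-- Apply `colorStep` to each vertex once. -/
noncomputable def colorPass (c : Fin n → ℕ) : Fin n → ℕ :=
  RAM.iterUpTo (fun i c => if h : i < n then G.colorStep ⟨i, h⟩ c else c) n c

/-- The colouring found by `n` passes. -/
noncomputable def greedyColoring : Fin n → ℕ :=
  RAM.iterUpTo (fun _ c => G.colorPass c) n fun _ => 0

/-- `c'` has the colours of `c` and perhaps more. -/
def Extends (c c' : Fin n → ℕ) : Prop := ∀ v, c v ≠ 0 → c' v = c v

theorem Extends.refl (c : Fin n → ℕ) : Extends c c := fun _ _ => rfl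

theorem Extends.trans {c c' c'' : Fin n → ℕ} (h : Extends c c') (h' : Extends c' c'') :
    Extends c c'' := fun v hv => (h' v (by rwa [h v hv])).trans (h v hv)

variable {G}

theorem extends_update {c : Fin n → ℕ} {w : Fin n} (hw : c w = 0) (i : ℕ) :
    Extends c (Function.update c w i) := fun v hv => by
  rw [Function.update_of_ne (by rintro rfl; exact hv hw)]

theorem extends_colorStep (w : Fin n) (c : Fin n → ℕ) : Extends c (G.colorStep w c) := by
  unfold colorStep
  split_ifs with h₁ h₂ h₃
  exacts [extends_update h₁.1 1, extends_update h₂.1 2, extends_update h₃.1 1, .refl c]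

theorem Extends.antisymm {c c' : Fin n → ℕ} (h : Extends c c') (h' : Extends c' c) : c = c' := by
  funext v
  by_cases hv : c v = 0
  · by_cases hv' : c' v = 0
    exacts [hv.trans hv'.symm, h' v hv']
  · exact (h v hv).symm

theorem colorStep_eq_self {w : Fin n} {c : Fin n → ℕ} (h : G.colorStep w c = c) :
    ¬ G.Forced c 1 2 w ∧ ¬ G.Forced c 2 1 w ∧ ¬ G.Undetermined c w := by
  have key : ∀ i, i ≠ 0 → c w = 0 → Function.update c w i ≠ c := fun i hi hw he => by
    have := congrFun he w
    simp only [Function.update_self] at this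
    omega
  unfold colorStep at h
  split_ifs at h with h₁ h₂ h₃
  exacts [absurd h (key 1 one_ne_zero h₁.1), absurd h (key 2 two_ne_zero h₂.1),
    absurd h (key 1 one_ne_zero h₃.1), ⟨h₁, h₂, h₃⟩]

/-- Steps only extend the colouring, so a pass without net effect was idle at every step. Then no
colour is forced, and an uncoloured vertex would be undetermined and get coloured. -/
theorem colorPass_spec (c : Fin n → ℕ) :
    Extends c (G.colorPass c) ∧ (G.colorPass c = c → ∀ v, c v ≠ 0) := by
  have key : Extends c (G.colorPass c) ∧
      (G.colorPass c = c → ∀ w : Fin n, w < n → G.colorStep w c = c) := by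
    refine RAM.iterUpTo_induction (fun i c' => Extends c c' ∧
      (c' = c → ∀ w : Fin n, w < i → G.colorStep w c = c)) ⟨.refl c, by simp⟩ ?_
    rintro i hi c' ⟨h, h'⟩
    simp only [hi, dif_pos]
    have he := extends_colorStep (G := G) ⟨i, hi⟩ c'
    refine ⟨h.trans he, fun hc w hw => ?_⟩
    have hcc : c' = c := (h.antisymm (hc ▸ he)).symm
    rcases Nat.lt_succ_iff_lt_or_eq.1 hw with hw | hw
    · exact h' hcc w hw
    · obtain rfl : w = ⟨i, hi⟩ := Fin.ext hw
      rwa [hcc] at hc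
  refine ⟨key.1, fun h v hv => ?_⟩
  have hs := fun w => colorStep_eq_self (key.2 h w w.2)
  exact (hs v).2.2 ⟨hv, fun ⟨w, hw⟩ => hw.elim (hs w).1 (hs w).2.1⟩

open Classical in
theorem greedyColoring_ne_zero (v : Fin n) : G.greedyColoring v ≠ 0 := by
  have key : n ≤ (Finset.univ.filter fun v => G.greedyColoring v ≠ 0).card ∨
      ∀ v, G.greedyColoring v ≠ 0 := by
    -- Every pass colours a new vertex until all are coloured, so `n` passes are enough.
    refine RAM.iterUpTo_induction (fun i (c : Fin n → ℕ) =>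
      i ≤ (Finset.univ.filter fun v => c v ≠ 0).card ∨ ∀ v, c v ≠ 0) (.inl (Nat.zero_le _)) ?_
    intro i hi c hc
    obtain ⟨h, h'⟩ := colorPass_spec (G := G) c
    by_cases hall : ∀ v, c v ≠ 0
    · exact .inr fun v => by rw [h v (hall v)]; exact hall v
    refine .inl ?_
    refine Nat.lt_of_le_of_lt (hc.resolve_right hall) (Finset.card_lt_card ?_)
    rw [Finset.ssubset_iff_of_subset fun v hv => by
      simp only [Finset.mem_filter, Finset.mem_univ, true_and] at hv ⊢
      rwa [h v hv]]
    by_contra hno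
    push Not at hno
    refine hall (h' (h.antisymm fun v hv => ?_).symm)
    exact (h v (by simpa using hno v (by simpa using hv))).symm
  rcases key with h | h
  · have : (Finset.univ.filter fun v => G.greedyColoring v ≠ 0) = Finset.univ :=
      Finset.eq_univ_of_card _ (le_antisymm (Finset.card_le_univ _) (by simpa using h))
    simpa using this.ge (Finset.mem_univ v)
  · exact h v

theorem greedyColoring_induction (I : (Fin n → ℕ) → Prop) (h0 : I fun _ => 0)
    (hs : ∀ w c, I c → I (G.colorStep w c)) : I G.greedyColoring := by
  refine RAM.iterUpTo_induction (fun _ c => I c) h0 fun _ _ c hc => ?_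
  refine RAM.iterUpTo_induction (fun _ c => I c) hc fun i hi c hc => ?_
  simp only [hi, dif_pos]
  exact hs _ c hc

theorem greedyColoring_le (v : Fin n) : G.greedyColoring v ≤ 2 := by
  refine greedyColoring_induction (fun c => ∀ v, c v ≤ 2) (by simp) (fun w c hc v => ?_) v
  unfold colorStep
  split_ifs <;> by_cases h : v = w <;> simp [h, hc]

theorem IsGoodColoring.forced {c g : Fin n → ℕ} (hg : G.IsGoodColoring g) (h : Extends c g)
    {i j : ℕ} {w : Fin n} (hij : (i = 1 ∧ j = 2) ∨ (i = 2 ∧ j = 1)) (hf : G.Forced c i j w) :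
    g w = i := by
  obtain ⟨-, u, ⟨hu, hl⟩ | ⟨hu, hl⟩⟩ := hf
  · rw [← hg.2.1 u w hl, h u (by omega), hu]
  · have h1 := hg.2.2 u w hl
    have h2 := hg.1 w
    rw [h u (by omega)] at h1
    omega

theorem Extends.update {c g : Fin n → ℕ} (h : Extends c g) {w : Fin n} {i : ℕ} (hi : g w = i) :
    Extends (Function.update c w i) g := fun v hv => by
  by_cases hvw : v = w
  · subst hvw; simpa using hi
  · rw [Function.update_of_ne hvw] at hv ⊢; exact h v hv

/-- If no colour is forced, the colours of the uncoloured vertices may be exchanged. -/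
theorem IsGoodColoring.swap {c g : Fin n → ℕ} (hg : G.IsGoodColoring g) (h : Extends c g)
    (hf : ¬ ∃ v, G.Forced c 1 2 v ∨ G.Forced c 2 1 v) :
    G.IsGoodColoring fun v => if c v = 0 then 3 - g v else g v := by
  push Not at hf
  -- No link or conflict joins a coloured vertex to an uncoloured one, since it would force a
  -- colour. Hence `3 - g v`, which exchanges 1 and 2, can be applied to the uncoloured part alone.
  have hmix : ∀ u w, c u ≠ 0 → c w = 0 → ¬ G.Linked u w ∧ ¬ G.Conflict u w := by
    intro u w hu hw
    have h1 := hg.1 u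
    rw [h u hu] at h1
    rcases h1 with h1 | h1
    · exact ⟨fun hl => (hf w).1 ⟨hw, u, .inl ⟨h1, hl⟩⟩, fun hl => (hf w).2 ⟨hw, u, .inr ⟨h1, hl⟩⟩⟩
    · exact ⟨fun hl => (hf w).2 ⟨hw, u, .inl ⟨h1, hl⟩⟩, fun hl => (hf w).1 ⟨hw, u, .inr ⟨h1, hl⟩⟩⟩
  refine ⟨fun v => ?_, fun u w hl => ?_, fun u w hl => ?_⟩
  · have := hg.1 v
    dsimp only
    split_ifs <;> omega
  · have := hg.2.1 u w hl
    dsimp only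
    split_ifs with hu hw hw
    · omega
    · exact absurd hl.symm (hmix w u hw hu).1
    · exact absurd hl (hmix u w hu hw).1
    · exact this
  · have := hg.2.2 u w hl
    have h1 := hg.1 u
    have h2 := hg.1 w
    dsimp only
    split_ifs with hu hw hw
    · omega
    · exact absurd hl.symm (hmix w u hw hu).2
    · exact absurd hl (hmix u w hu hw).2
    · exact this

/-- Invariant: the partial colouring extends to some good colouring `g`. Forced steps agree with
`g`; an arbitrary choice that disagrees is repaired by `IsGoodColoring.swap`. At the end every
vertex is coloured, so the result is `g` itself. -/
theorem isGoodColoring_greedyColoring (h : ∃ g, G.IsGoodColoring g) :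
    G.IsGoodColoring G.greedyColoring := by
  obtain ⟨g, hg, hext⟩ : ∃ g, G.IsGoodColoring g ∧ Extends G.greedyColoring g := by
    refine greedyColoring_induction (fun c => ∃ g, G.IsGoodColoring g ∧ Extends c g) ?_ ?_
    · obtain ⟨g, hg⟩ := h
      exact ⟨g, hg, fun v hv => absurd rfl hv⟩
    · rintro w c ⟨g, hg, hext⟩
      unfold colorStep
      split_ifs with h₁ h₂ h₃
      · exact ⟨g, hg, hext.update (hg.forced hext (by simp) h₁)⟩
      · exact ⟨g, hg, hext.update (hg.forced hext (by simp) h₂)⟩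
      · by_cases hw : g w = 1
        · exact ⟨g, hg, hext.update hw⟩
        · refine ⟨_, hg.swap hext h₃.2, Extends.update (fun v hv => ?_) ?_⟩
          · simp [hv, hext v hv]
          · have := hg.1 w
            simp only [h₃.1, if_true]
            omega
      · exact ⟨g, hg, hext⟩
  have : G.greedyColoring = g := funext fun v => (hext v (greedyColoring_ne_zero v)).symm
  rwa [this]

end Coloring

end SimpleGraph

namespace RAM

/-! ### Formulas about graphs -/

namespace Form

/-- Array `0` holds the adjacency matrix, in which row `u` begins at the entry `u` of array `1`;
array `2` holds the function `c`. -/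
def Mem {n : ℕ} (G : SimpleGraph (Fin n)) (c : Fin n → ℕ) (A : ℕ → ℕ → ℕ) : Prop :=
  (∀ u v : Fin n, A 0 (A 1 u + v) ≠ 0 ↔ G.Adj u v) ∧ ∀ u : Fin n, A 2 u = c u

/-- Register `a` is below `d` and holds `v`. -/
def IsVar {n : ℕ} (s : State) (d a : ℕ) (v : Fin n) : Prop := a < d ∧ s.reg a = v

theorem IsVar.lift {n : ℕ} {s : State} {d a : ℕ} {v : Fin n} (h : IsVar s d a v) {x : ℕ} :
    IsVar (s.setReg d x) (d + 2) a v :=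
  ⟨by have := h.1; omega, by
    simpa [State.setReg, Function.update_of_ne h.1.ne] using h.2⟩

theorem IsVar.new {n : ℕ} {s : State} {d : ℕ} {v : Fin n} : IsVar (s.setReg d v) (d + 2) d v :=
  ⟨by omega, by simp [State.setReg]⟩

/-- `u` and `v` are adjacent. -/
def adj (u v : ℕ) : Form := test (.cell 0 (.add (.cell 1 (.reg u)) (.reg v)))

/-- `u = v`. -/
def equal (u v : ℕ) : Form := test (.eq (.reg u) (.reg v))

/-- `u < v`. -/
def less (u v : ℕ) : Form := test (.lt (.reg u) (.reg v))

/-- The colour of `u` is `i`. -/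
def hasColor (i u : ℕ) : Form := test (.eq (.cell 2 (.reg u)) (.const i))

/-- The colours of `u` and `v` are equal. -/
def sameColor (u v : ℕ) : Form := test (.eq (.cell 2 (.reg u)) (.cell 2 (.reg v)))

/-- `SimpleGraph.IsSimplicial`. -/
def simplicial (d v : ℕ) : Form :=
  neg (ex (ex (and (adj v d) (and (adj v (d + 2))
    (and (neg (equal d (d + 2))) (neg (adj d (d + 2))))))))

/-- `SimpleGraph.InClosedNhd`. -/
def closedNhd (v u : ℕ) : Form := or (equal u v) (adj v u)

/-- `SimpleGraph.IsRep`. -/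
def rep (d v : ℕ) : Form :=
  and (simplicial d v) (neg (ex (and (less d v) (and (simplicial (d + 2) d) (adj d v)))))

/-- `SimpleGraph.Uncovered`. -/
def uncovered (d u w : ℕ) : Form :=
  and (adj u w) (neg (ex (and (rep (d + 2) d) (and (closedNhd d u) (closedNhd d w)))))

/-- `SimpleGraph.IsEnd`. -/
def isEnd (d u : ℕ) : Form := ex (uncovered (d + 2) u d)

/-- `SimpleGraph.Conflict`. -/
def conflict (d u w : ℕ) : Form :=
  and (isEnd d u) (and (isEnd d w) (and (neg (equal u w)) (neg (adj u w))))

/-- `SimpleGraph.InConflict`. -/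
def inConflict (d u : ℕ) : Form := ex (conflict (d + 2) u d)

/-- `SimpleGraph.Linked`. -/
def linked (d u w : ℕ) : Form := and (uncovered d u w) (and (inConflict d u) (inConflict d w))

/-- `SimpleGraph.IsFree`. -/
def free (d v : ℕ) : Form := neg (ex (and (rep (d + 2) d) (closedNhd d v)))

/-- `SimpleGraph.Forced`. -/
def forced (d i j w : ℕ) : Form :=
  and (hasColor 0 w) (ex (or (and (hasColor i d) (linked (d + 2) d w))
    (and (hasColor j d) (conflict (d + 2) d w))))

/-- `SimpleGraph.Undetermined`. -/
def undetermined (d w : ℕ) : Form :=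
  and (hasColor 0 w) (neg (ex (or (forced (d + 2) 1 2 d) (forced (d + 2) 2 1 d))))

/-- `SimpleGraph.InColorClass`. -/
def colorClass (d i u : ℕ) : Form := and (isEnd d u) (or (neg (inConflict d u)) (hasColor i u))

/-- The colouring violates a link or a conflict. -/
def badColoring (d : ℕ) : Form :=
  ex (ex (or (and (linked (d + 4) d (d + 2)) (neg (sameColor d (d + 2))))
    (and (conflict (d + 4) d (d + 2)) (sameColor d (d + 2)))))

section Holds

variable {n : ℕ} {G : SimpleGraph (Fin n)} {c : Fin n → ℕ} {s : State} {d a b : ℕ} {u v : Fin n}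

theorem holds_adj (hm : Mem G c s.arr) (hu : IsVar s d a u) (hv : IsVar s d b v) :
    (adj a b).Holds n d s ↔ G.Adj u v := by
  simpa [adj, Holds, Expr.eval, hu.2, hv.2] using hm.1 u v

theorem holds_equal (hu : IsVar s d a u) (hv : IsVar s d b v) :
    (equal a b).Holds n d s ↔ u = v := by
  simp [equal, Holds, Expr.eval, hu.2, hv.2, Fin.ext_iff]

theorem holds_less (hu : IsVar s d a u) (hv : IsVar s d b v) :
    (less a b).Holds n d s ↔ u < v := by
  simp [less, Holds, Expr.eval, hu.2, hv.2]

theorem holds_hasColor (hm : Mem G c s.arr) (hu : IsVar s d a u) {i : ℕ} :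
    (hasColor i a).Holds n d s ↔ c u = i := by
  simp [hasColor, Holds, Expr.eval, hu.2, hm.2]

theorem holds_sameColor (hm : Mem G c s.arr) (hu : IsVar s d a u) (hv : IsVar s d b v) :
    (sameColor a b).Holds n d s ↔ c u = c v := by
  simp [sameColor, Holds, Expr.eval, hu.2, hv.2, hm.2]

theorem holds_simplicial (hm : Mem G c s.arr) (hu : IsVar s d a u) :
    (simplicial d a).Holds n d s ↔ G.IsSimplicial u := by
  have : G.IsSimplicial u ↔ ¬ ∃ i j, G.Adj u i ∧ G.Adj u j ∧ ¬ i = j ∧ ¬ G.Adj i j := by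
    simp only [SimpleGraph.IsSimplicial]
    push Not
    exact ⟨fun h i j => h i j, fun h i j => h i j⟩
  rw [this]
  exact not_congr <| exists_congr fun i => exists_congr fun j =>
    and_congr (holds_adj hm hu.lift.lift IsVar.new.lift) <|
    and_congr (holds_adj hm hu.lift.lift .new) <|
    and_congr (not_congr (holds_equal IsVar.new.lift .new))
      (not_congr (holds_adj hm IsVar.new.lift .new))

theorem holds_closedNhd (hm : Mem G c s.arr) (hu : IsVar s d a u) (hv : IsVar s d b v) :
    (closedNhd a b).Holds n d s ↔ G.InClosedNhd u v :=
  holds_or.trans (or_congr (holds_equal hv hu) (holds_adj hm hu hv))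

theorem holds_rep (hm : Mem G c s.arr) (hu : IsVar s d a u) :
    (rep d a).Holds n d s ↔ G.IsRep u :=
  and_congr (holds_simplicial hm hu) <| not_congr <| exists_congr fun _ =>
    and_congr (holds_less .new hu.lift) <|
    and_congr (holds_simplicial hm .new) (holds_adj hm .new hu.lift)

theorem holds_uncovered (hm : Mem G c s.arr) (hu : IsVar s d a u) (hv : IsVar s d b v) :
    (uncovered d a b).Holds n d s ↔ G.Uncovered u v :=
  and_congr (holds_adj hm hu hv) <| not_congr <| exists_congr fun _ =>
    and_congr (holds_rep hm .new) <|
    and_congr (holds_closedNhd hm .new hu.lift) (holds_closedNhd hm .new hv.lift)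

theorem holds_isEnd (hm : Mem G c s.arr) (hu : IsVar s d a u) :
    (isEnd d a).Holds n d s ↔ G.IsEnd u :=
  exists_congr fun _ => holds_uncovered hm hu.lift .new

theorem holds_conflict (hm : Mem G c s.arr) (hu : IsVar s d a u) (hv : IsVar s d b v) :
    (conflict d a b).Holds n d s ↔ G.Conflict u v :=
  and_congr (holds_isEnd hm hu) <| and_congr (holds_isEnd hm hv) <|
    and_congr (not_congr (holds_equal hu hv)) (not_congr (holds_adj hm hu hv))

theorem holds_inConflict (hm : Mem G c s.arr) (hu : IsVar s d a u) :
    (inConflict d a).Holds n d s ↔ G.InConflict u :=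
  exists_congr fun _ => holds_conflict hm hu.lift .new

theorem holds_linked (hm : Mem G c s.arr) (hu : IsVar s d a u) (hv : IsVar s d b v) :
    (linked d a b).Holds n d s ↔ G.Linked u v :=
  and_congr (holds_uncovered hm hu hv) <|
    and_congr (holds_inConflict hm hu) (holds_inConflict hm hv)

theorem holds_free (hm : Mem G c s.arr) (hu : IsVar s d a u) :
    (free d a).Holds n d s ↔ G.IsFree u :=
  not_congr <| exists_congr fun _ =>
    and_congr (holds_rep hm .new) (holds_closedNhd hm .new hu.lift)

theorem holds_forced (hm : Mem G c s.arr) (hu : IsVar s d a u) {i j : ℕ} :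
    (forced d i j a).Holds n d s ↔ G.Forced c i j u :=
  and_congr (holds_hasColor hm hu) <| exists_congr fun v => holds_or.trans <|
    or_congr (and_congr (holds_hasColor (s := s.setReg d v) hm .new)
        (holds_linked hm .new hu.lift))
      (and_congr (holds_hasColor (s := s.setReg d v) hm .new) (holds_conflict hm .new hu.lift))

theorem holds_undetermined (hm : Mem G c s.arr) (hu : IsVar s d a u) :
    (undetermined d a).Holds n d s ↔ G.Undetermined c u :=
  and_congr (holds_hasColor hm hu) <| not_congr <| exists_congr fun v => holds_or.trans <|
    or_congr (holds_forced (s := s.setReg d v) hm .new)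
      (holds_forced (s := s.setReg d v) hm .new)

theorem holds_colorClass (hm : Mem G c s.arr) (hu : IsVar s d a u) {i : ℕ} :
    (colorClass d i a).Holds n d s ↔ G.InColorClass c i u :=
  and_congr (holds_isEnd hm hu) <| holds_or.trans <|
    or_congr (not_congr (holds_inConflict hm hu)) (holds_hasColor hm hu)

theorem holds_badColoring (hm : Mem G c s.arr) :
    (badColoring d).Holds n d s ↔
      ∃ u w, (G.Linked u w ∧ ¬ c u = c w) ∨ (G.Conflict u w ∧ c u = c w) :=
  exists_congr fun _ => exists_congr fun _ => holds_or.trans <|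
    or_congr (and_congr (holds_linked hm IsVar.new.lift .new)
        (not_congr (holds_sameColor hm IsVar.new.lift .new)))
      (and_congr (holds_conflict hm IsVar.new.lift .new)
        (holds_sameColor hm IsVar.new.lift .new))

end Holds

end Form

/-! ### The programs -/

namespace LoopProg

/-- Agreement of the registers below `d` and the arrays. -/
def Frame (d : ℕ) (s s' : State) : Prop := (∀ r < d, s'.reg r = s.reg r) ∧ s'.arr = s.arr

theorem Frame.trans {d : ℕ} {s s' s'' : State} (h : Frame d s s') (h' : Frame d s' s'') :
    Frame d s s'' :=
  ⟨fun r hr => (h'.1 r hr).trans (h.1 r hr), h'.2.trans h.2⟩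

theorem Frame.mono {d d' : ℕ} (hd : d ≤ d') {s s' : State} (h : Frame d' s s') : Frame d s s' :=
  ⟨fun r hr => h.1 r (by omega), h.2⟩

theorem frame_setReg {d r : ℕ} (hr : d ≤ r) (s : State) (x : ℕ) : Frame d s (s.setReg r x) :=
  ⟨(State.Agree.setReg hr s x).1, rfl⟩

theorem _root_.RAM.State.Agree.frame {d : ℕ} {s s' : State} (h : s.Agree d s') : Frame d s s' :=
  ⟨h.1, h.2.1⟩

/-- A loop whose body appends `g u` to the output in round `u`. -/
theorem run_loop_out {n r : ℕ} {P : LoopProg} {s : State} (g : Fin n → List Bool)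
    (h : ∀ (u : Fin n) (b : State), Frame r s b →
      Frame r s (P.run n (b.setReg r u)) ∧ (P.run n (b.setReg r u)).out = b.out ++ g u) :
    Frame r s ((loop r P).run n s) ∧
      ((loop r P).run n s).out = s.out ++ (List.finRange n).flatMap g := by
  have key := iterUpTo_induction (f := fun i s => P.run n (s.setReg r i)) (n := n) (a := s)
    (fun i b => Frame r s b ∧ b.out = s.out ++ ((List.finRange n).take i).flatMap g)
    ⟨⟨fun _ _ => rfl, rfl⟩, by simp⟩ (fun i hi b hb => by
      obtain ⟨h₁, h₂⟩ := h ⟨i, hi⟩ b hb.1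
      refine ⟨h₁, h₂.trans ?_⟩
      rw [hb.2, List.take_add_one]
      simp [hi])
  refine ⟨key.1.trans (frame_setReg le_rfl _ _), ?_⟩
  have := key.2
  rw [List.take_of_length_le (by simp)] at this
  exact this

open Classical in
/-- Printing the characteristic vector of a set that is given by a formula. -/
theorem run_loop_printTruth {n r : ℕ} {φ : Form} (hφ : φ.wellScoped (r + 2)) (hr : r % 2 = 0)
    {s : State} (p : Fin n → Prop) (h : ∀ u : Fin n, φ.Holds n (r + 2) (s.setReg r u) ↔ p u) :
    Frame r s ((loop r (φ.printTruth (r + 2))).run n s) ∧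
      ((loop r (φ.printTruth (r + 2))).run n s).out =
        s.out ++ (List.finRange n).map fun u => decide (p u) := by
  rw [List.map_eq_flatMap]
  refine run_loop_out _ fun u b hb => ?_
  obtain ⟨s', hs', he⟩ := Form.run_printTruth (n := n) hφ (b.setReg r u)
  have hsv : s.SameVars r b := ⟨fun q hq _ => hb.1 q hq, hb.2⟩
  rw [he]
  constructor
  · exact (hb.trans (frame_setReg le_rfl _ _)).trans (hs'.frame.mono (by omega))
  · refine congrArg₂ (· ++ [·]) hs'.2.2 ?_
    exact decide_eq_decide.2 ((Form.holds_congr hφ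
      ((hsv.setReg u).resolve_right (by omega))).trans (h u))

/-- Fill array `1` with the multiples of register `2`. -/
def multiples : LoopProg :=
  .seq (.set 5 (.const 0)) (.loop 4 (.seq (.store 1 (.reg 4) (.reg 5))
    (.set 5 (.add (.reg 5) (.reg 2)))))

/-- The machine has no multiplication: register `5` holds `i * n` at the start of round `i` by
repeated addition, which makes matrix entries addressable. -/
theorem run_multiples {n : ℕ} {s : State} (hs : s.reg 2 = n) :
    (∀ u < n, (multiples.run n s).arr 1 u = u * n) ∧
      (∀ a ≠ 1, (multiples.run n s).arr a = s.arr a) ∧ (multiples.run n s).out = s.out := by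
  have key := iterUpTo_induction (n := n) (a := s.setReg 5 0)
    (f := fun i s => (LoopProg.seq (.store 1 (.reg 4) (.reg 5))
      (.set 5 (.add (.reg 5) (.reg 2)))).run n (s.setReg 4 i))
    (fun i b => b.reg 2 = n ∧ b.reg 5 = i * n ∧ (∀ u < i, b.arr 1 u = u * n) ∧
      (∀ a ≠ 1, b.arr a = s.arr a) ∧ b.out = s.out)
    ⟨by simp [State.setReg, hs], by simp [State.setReg], by simp, fun _ _ => rfl, rfl⟩
    (fun i hi b ⟨h₁, h₂, h₃, h₄, h₅⟩ => by
      refine ⟨?_, ?_, fun u hu => ?_, fun a ha => ?_, h₅⟩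
      · simp [run, State.setReg, State.setCell, h₁]
      · simp [run, State.setReg, State.setCell, Expr.eval, h₁, h₂]; ring
      · rcases Nat.lt_succ_iff_lt_or_eq.1 hu with hu | rfl
        · simp [run, State.setReg, State.setCell, Expr.eval, Function.update_of_ne hu.ne, h₃ u hu]
        · simp [run, State.setReg, State.setCell, Expr.eval, h₂]
      · simp [run, State.setReg, State.setCell, Function.update_of_ne ha, h₄ a ha])
  exact key.2.2

/-- Print the closed neighbourhoods of the representatives. -/
def printReps : LoopProg :=
  .loop 4 (Form.branch 6 (.rep 6 4) (.loop 6 (Form.printTruth 8 (.closedNhd 4 6))) .skip)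

open Classical in
theorem run_printReps {n : ℕ} {G : SimpleGraph (Fin n)} {c : Fin n → ℕ} {s : State}
    (hm : Form.Mem G c s.arr) :
    (printReps.run n s).arr = s.arr ∧ (printReps.run n s).out = s.out ++
      (List.finRange n).flatMap fun v => if G.IsRep v then
        (List.finRange n).map fun u => decide (G.InClosedNhd v u) else [] := by
  refine (run_loop_out _ fun v b hb => ?_).imp And.right id
  obtain ⟨s', hs', h₁, h₂⟩ := Form.run_branch (n := n) (d := 6) (φ := .rep 6 4) (by decide)
    (.loop 6 (Form.printTruth 8 (.closedNhd 4 6))) .skip (b.setReg 4 v)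
  have hmb : Form.Mem G c (b.setReg 4 v).arr := by rw [← hb.2] at hm; exact hm
  rw [Form.holds_rep hmb .new] at h₁ h₂
  have hf : Frame 4 s s' :=
    (hb.trans (frame_setReg le_rfl _ _)).trans (hs'.frame.mono (by omega))
  by_cases hv : G.IsRep v
  · rw [h₁ hv, if_pos hv]
    have hm' : Form.Mem G c s'.arr := by rw [hs'.2.1]; exact hmb
    obtain ⟨k₁, k₂⟩ := run_loop_printTruth (n := n) (r := 6) (φ := .closedNhd 4 6) (by decide)
      rfl (s := s') (G.InClosedNhd v) fun u => Form.holds_closedNhd (s := s'.setReg 6 u) hm'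
        (Form.IsVar.lift ⟨by omega, by rw [hs'.1 4 (by omega)]; simp [State.setReg]⟩) .new
    exact ⟨hf.trans (k₁.mono (by omega)), k₂.trans (congrArg (· ++ _) hs'.2.2)⟩
  · rw [h₂ hv, if_neg hv]
    exact ⟨hf, by rw [List.append_nil]; exact hs'.2.2⟩

/-- Print a colour class. -/
def printClass (i : ℕ) : LoopProg := .loop 4 (Form.printTruth 6 (.colorClass 6 i 4))

open Classical in
theorem run_printClass {n : ℕ} {G : SimpleGraph (Fin n)} {c : Fin n → ℕ} {s : State}
    (hm : Form.Mem G c s.arr) (i : ℕ) :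
    ((printClass i).run n s).arr = s.arr ∧ ((printClass i).run n s).out = s.out ++
      (List.finRange n).map fun u => decide (G.InColorClass c i u) :=
  (run_loop_printTruth (r := 4) (φ := .colorClass 6 i 4) (by rfl) rfl (G.InColorClass c i)
    fun u => Form.holds_colorClass (s := s.setReg 4 u) hm .new).imp And.right id

/-- Colour the vertex in register `6` if its colour is forced or arbitrary. -/
def colorVertex : LoopProg :=
  Form.branch 8 (.forced 8 1 2 6) (.store 2 (.reg 6) (.const 1))
    (Form.branch 8 (.forced 8 2 1 6) (.store 2 (.reg 6) (.const 2))
      (Form.branch 8 (.undetermined 8 6) (.store 2 (.reg 6) (.const 1)) .skip))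

theorem run_store_color {n : ℕ} {G : SimpleGraph (Fin n)} {c : Fin n → ℕ} {s : State}
    (hm : Form.Mem G c s.arr) {w : Fin n} (hw : s.reg 6 = w) (i : ℕ) :
    Form.Mem G (Function.update c w i) ((store 2 (.reg 6) (.const i)).run n s).arr := by
  refine ⟨fun u v => ?_, fun u => ?_⟩
  · simpa [run, State.setCell] using hm.1 u v
  · by_cases huw : u = w
    · subst huw; simp [run, State.setCell, Expr.eval, hw]
    · have : (u : ℕ) ≠ w := fun h => huw (Fin.ext h)
      simpa [run, State.setCell, Expr.eval, hw, Function.update_of_ne huw,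
        Function.update_of_ne this] using hm.2 u

theorem run_colorVertex {n : ℕ} {G : SimpleGraph (Fin n)} {c : Fin n → ℕ} {s : State}
    (hm : Form.Mem G c s.arr) {w : Fin n} (hw : s.reg 6 = w) :
    Form.Mem G (G.colorStep w c) (colorVertex.run n s).arr ∧
      (colorVertex.run n s).out = s.out := by
  -- Evaluating a condition at level 8 preserves the arrays and the vertex in register `6`, so the
  -- next condition sees the same colouring.
  have hag : ∀ {s s' : State}, s.Agree 8 s' → Form.Mem G c s.arr → s.reg 6 = w →
      Form.Mem G c s'.arr ∧ s'.reg 6 = w := fun h hm hw =>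
    ⟨by rw [h.2.1]; exact hm, by rw [h.1 6 (by omega), hw]⟩
  unfold SimpleGraph.colorStep colorVertex
  obtain ⟨s', hs', h₁, h₂⟩ := Form.run_branch (n := n) (d := 8) (φ := .forced 8 1 2 6) (by decide)
    (.store 2 (.reg 6) (.const 1)) (Form.branch 8 (.forced 8 2 1 6) (.store 2 (.reg 6) (.const 2))
      (Form.branch 8 (.undetermined 8 6) (.store 2 (.reg 6) (.const 1)) .skip)) s
  rw [Form.holds_forced hm ⟨by omega, hw⟩] at h₁ h₂
  obtain ⟨hm, hw⟩ := hag hs' hm hw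
  split_ifs with c₁ c₂ c₃
  · rw [h₁ c₁]
    exact ⟨run_store_color hm hw 1, hs'.2.2⟩
  all_goals
    rw [h₂ c₁]
    obtain ⟨s'', hs'', h₁, h₂⟩ := Form.run_branch (n := n) (d := 8) (φ := .forced 8 2 1 6) (by decide)
      (.store 2 (.reg 6) (.const 2))
      (Form.branch 8 (.undetermined 8 6) (.store 2 (.reg 6) (.const 1)) .skip) s'
    rw [Form.holds_forced hm ⟨by omega, hw⟩] at h₁ h₂
    obtain ⟨hm, hw⟩ := hag hs'' hm hw
    have hs' := hs'.trans hs''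
  · rw [h₁ c₂]
    exact ⟨run_store_color hm hw 2, hs'.2.2⟩
  all_goals
    rw [h₂ c₂]
    obtain ⟨s₃, hs₃, h₁, h₂⟩ := Form.run_branch (n := n) (d := 8) (φ := .undetermined 8 6) (by decide)
      (.store 2 (.reg 6) (.const 1)) .skip s''
    rw [Form.holds_undetermined hm ⟨by omega, hw⟩] at h₁ h₂
    obtain ⟨hm, hw⟩ := hag hs₃ hm hw
    have hs' := hs'.trans hs₃
  · rw [h₁ c₃]
    exact ⟨run_store_color hm hw 1, hs'.2.2⟩
  · rw [h₂ c₃]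
    exact ⟨hm, hs'.2.2⟩

/-- Compute `SimpleGraph.greedyColoring`. -/
def colorAll : LoopProg := .loop 4 (.loop 6 colorVertex)

theorem run_colorAll {n : ℕ} {G : SimpleGraph (Fin n)} {s : State}
    (hm : Form.Mem G (fun _ => 0) s.arr) :
    Form.Mem G G.greedyColoring (colorAll.run n s).arr ∧ (colorAll.run n s).out = s.out := by
  have pass : ∀ (c : Fin n → ℕ) (s : State), Form.Mem G c s.arr →
      Form.Mem G (G.colorPass c) ((loop 6 colorVertex).run n s).arr ∧
        ((loop 6 colorVertex).run n s).out = s.out := by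
    intro c s hm
    -- The final assignment to the loop counter can be ignored: it touches neither arrays nor
    -- output.
    suffices h : ∀ i ≤ n, Form.Mem G
        (iterUpTo (fun i c => if h : i < n then G.colorStep ⟨i, h⟩ c else c) i c)
        (iterUpTo (fun i s => colorVertex.run n (s.setReg 6 i)) i s).arr ∧
        (iterUpTo (fun i s => colorVertex.run n (s.setReg 6 i)) i s).out = s.out from h n le_rfl
    intro i hi
    induction i with
    | zero => exact ⟨hm, rfl⟩
    | succ i ih =>
      obtain ⟨h₁, h₂⟩ := ih (by omega)
      obtain ⟨k₁, k₂⟩ := run_colorVertex (s := State.setReg _ 6 i) h₁ (w := ⟨i, hi⟩)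
        (by simp [State.setReg])
      refine ⟨?_, k₂.trans h₂⟩
      simpa only [iterUpTo, dif_pos (show i < n from hi)] using k₁
  suffices h : ∀ i, Form.Mem G (iterUpTo (fun _ c => G.colorPass c) i fun _ => 0)
      (iterUpTo (fun i s => (loop 6 colorVertex).run n (s.setReg 4 i)) i s).arr ∧
      (iterUpTo (fun i s => (loop 6 colorVertex).run n (s.setReg 4 i)) i s).out = s.out from h n
  intro i
  induction i with
  | zero => exact ⟨hm, rfl⟩
  | succ i ih =>
    obtain ⟨k₁, k₂⟩ := pass _ (State.setReg _ 4 i) ih.1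
    exact ⟨k₁, k₂.trans ih.2⟩

/-- Print `no`. -/
def printNo : LoopProg := .print (.const 0)

/-- Print `yes`, the closed neighbourhoods of the representatives, and then run `P`. -/
def printYes (P : LoopProg) : LoopProg := .seq (.print (.const 1)) (.seq printReps P)

/-- Find an edge clique cover with at most `α(G)` cliques. -/
def coverProg : LoopProg :=
  .seq multiples (Form.branch 4 (.ex (.ex (.uncovered 8 4 6))) printNo (printYes .skip))

/-- Find an edge clique cover with at most `α(G) + 1` cliques. -/
def coverSuccProg : LoopProg :=
  .seq multiples (.seq colorAll (Form.branch 4 (.ex (.free 6 4))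
    (Form.branch 4 (.badColoring 4) printNo (printYes (.seq (printClass 1) (printClass 2))))
    (Form.branch 4 (.ex (.inConflict 6 4)) printNo (printYes (printClass 1)))))

theorem coverProg_wf : coverProg.Wf := by
  simp [coverProg, multiples, printNo, printYes, printReps, Form.branch, Form.printTruth, Wf,
    Writes, Form.prog_wf, Form.not_writes_prog]

theorem coverSuccProg_wf : coverSuccProg.Wf := by
  simp [coverSuccProg, multiples, printNo, printYes, printReps, printClass, colorAll, colorVertex,
    Form.branch, Form.printTruth, Wf, Writes, Form.prog_wf, Form.not_writes_prog]

end LoopProg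

end RAM

/-! ### Correctness of the answers -/

namespace ECCAboveIndependentSet

open SimpleGraph

theorem flatMap_filter {α β : Type*} (l : List α) (p : α → Prop) [DecidablePred p]
    (f : α → List β) :
    (l.filter fun a => decide (p a)).flatMap f = l.flatMap fun a => if p a then f a else [] := by
  induction l with
  | nil => rfl
  | cons a l ih => by_cases h : p a <;> simp [h, ih]

section Answers

variable {n : ℕ} (G : SimpleGraph (Fin n))

open Classical in
/-- The closed neighbourhoods of the representatives. -/
noncomputable def repCliques : List (Finset (Fin n)) :=
  ((List.finRange n).filter fun v => decide (G.IsRep v)).map fun v =>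
    Finset.univ.filter (G.InClosedNhd v)

open Classical in
/-- The vertices in the clique of colour `i`. -/
noncomputable def colorClique (c : Fin n → ℕ) (i : ℕ) : Finset (Fin n) :=
  Finset.univ.filter (G.InColorClass c i)

open Classical in
theorem encodeSets_repCliques : encodeSets (repCliques G) =
    (List.finRange n).flatMap fun v => if G.IsRep v then
      (List.finRange n).map fun u => decide (G.InClosedNhd v u) else [] := by
  unfold encodeSets repCliques
  rw [List.flatMap_map, flatMap_filter]
  simp

theorem length_repCliques : (repCliques G).length = G.reps.card := by
  classical
  rw [repCliques, List.length_map, ← List.toFinset_card_of_nodup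
    ((List.nodup_finRange n).filter _)]
  congr 1
  ext v
  simp

theorem encodeSets_append (L L' : List (Finset (Fin n))) :
    encodeSets (L ++ L') = encodeSets L ++ encodeSets L' := by
  simp [encodeSets]

open Classical in
theorem encodeSets_colorClique (c : Fin n → ℕ) (i : ℕ) : encodeSets [colorClique G c i] =
    (List.finRange n).map fun u => decide (G.InColorClass c i u) := by
  simp [encodeSets, colorClique]

/-- Every edge is uncovered or lies in the closed neighbourhood of a representative, which is a
clique. -/
theorem isEdgeCliqueCover_repCliques_append {L : List (Finset (Fin n))}
    (hL : ∀ K ∈ L, G.IsClique (K : Set (Fin n)))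
    (h : ∀ u w, G.Uncovered u w → ∃ K ∈ L, u ∈ K ∧ w ∈ K) :
    G.IsEdgeCliqueCover (repCliques G ++ L).toFinset := by
  classical
  constructor
  · intro K hK
    simp only [List.mem_toFinset, List.mem_append, repCliques, List.mem_map, List.mem_filter,
      decide_eq_true_eq] at hK
    rcases hK with ⟨v, hv, rfl⟩ | hK
    · simpa using hv.2.1.isClique
    · exact hL K hK
  · intro u w huw
    by_cases hc : ∃ v, G.IsRep v ∧ G.InClosedNhd v u ∧ G.InClosedNhd v w
    · obtain ⟨v, hv, hu, hw⟩ := hc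
      refine ⟨Finset.univ.filter (G.InClosedNhd v), ?_, by simpa using hu, by simpa using hw⟩
      simp only [List.mem_toFinset, List.mem_append, repCliques, List.mem_map, List.mem_filter,
        decide_eq_true_eq]
      exact .inl ⟨v, ⟨List.mem_finRange v, hv⟩, by congr⟩
    · obtain ⟨K, hK, hu, hw⟩ := h u w ⟨huw, hc⟩
      exact ⟨K, by simp [hK], hu, hw⟩

end Answers

section Programs

open RAM RAM.LoopProg RAM.Form

variable {n : ℕ} {G : SimpleGraph (Fin n)} {c : Fin n → ℕ} {s : State}

theorem run_printYes (hm : Mem G c s.arr) (P : LoopProg) :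
    ∃ s', (printYes P).run n s = P.run n s' ∧ s'.arr = s.arr ∧
      s'.out = s.out ++ true :: encodeSets (repCliques G) := by
  obtain ⟨h₁, h₂⟩ := run_printReps (n := n) (s := s.emit true) hm
  refine ⟨_, rfl, h₁, h₂.trans ?_⟩
  rw [encodeSets_repCliques]
  simp [State.emit]

/-- The adjacency matrix is in array `0`, and array `2` and the output are empty. -/
def IsStart (G : SimpleGraph (Fin n)) (s : State) : Prop :=
  s.reg 2 = n ∧ (∀ u v : Fin n, s.arr 0 (u * n + v) ≠ 0 ↔ G.Adj u v) ∧
    (∀ i, s.arr 2 i = 0) ∧ s.out = []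

/-- The empty array `2` serves as the colouring in which every vertex is still uncoloured. -/
theorem IsStart.mem_run_multiples (h : IsStart G s) :
    Mem G (fun _ => 0) (multiples.run n s).arr ∧ (multiples.run n s).out = [] := by
  obtain ⟨h₁, h₂, h₃⟩ := run_multiples h.1
  refine ⟨⟨fun u v => ?_, fun u => ?_⟩, h₃.trans h.2.2.2⟩
  · rw [h₁ u u.2, h₂ 0 (by omega)]; exact h.2.1 u v
  · rw [h₂ 2 (by omega)]; exact h.2.2.1 u

theorem run_coverProg (x : Instance) {s : State} (h : IsStart x.graph s) :
    IsAnswer 0 x (coverProg.run x.n s).out := by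
  obtain ⟨hm, ho⟩ := h.mem_run_multiples
  obtain ⟨s', hs', h₁, h₂⟩ := run_branch (n := x.n) (d := 4)
    (φ := .ex (.ex (.uncovered 8 4 6))) (by decide) printNo (printYes .skip)
    (multiples.run x.n s)
  have hφ : (Form.ex (.ex (.uncovered 8 4 6))).Holds x.n 4 (multiples.run x.n s) ↔
      ∃ u w, x.graph.Uncovered u w :=
    exists_congr fun _ => exists_congr fun _ => holds_uncovered hm IsVar.new.lift .new
  rw [hφ] at h₁ h₂
  rw [← hs'.2.1] at hm
  rw [← hs'.2.2] at ho
  rw [coverProg, LoopProg.run]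
  by_cases hu : ∃ u w, x.graph.Uncovered u w
  · refine .inr ⟨fun ⟨𝒦, h𝒦, hc⟩ => ?_, ?_⟩
    · obtain ⟨u, w, hu⟩ := hu
      exact h𝒦.not_uncovered x.no_isolated hc u w hu
    · rw [h₁ hu]; simp [printNo, LoopProg.run, State.emit, ho, Expr.eval]
  · obtain ⟨s'', he, -, hout⟩ := run_printYes hm .skip
    refine .inl ⟨repCliques x.graph ++ [], isEdgeCliqueCover_repCliques_append _ (by simp)
      fun u w huw => absurd ⟨u, w, huw⟩ hu, ?_, ?_⟩
    · rw [List.append_nil, length_repCliques]; exact card_reps_le_indepNum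
    · rw [h₂ hu, he, LoopProg.run, hout, ho, List.append_nil, List.nil_append]

theorem run_coverSuccProg (x : Instance) {s : State} (h : IsStart x.graph s) :
    IsAnswer 1 x (coverSuccProg.run x.n s).out := by
  obtain ⟨hm, ho⟩ := h.mem_run_multiples
  obtain ⟨hm, ho'⟩ := run_colorAll hm
  rw [ho] at ho'
  rw [coverSuccProg, LoopProg.run, LoopProg.run]
  generalize colorAll.run x.n (multiples.run x.n s) = s₀ at hm ho'
  set c := x.graph.greedyColoring with hc
  obtain ⟨s', hs', h₁, h₂⟩ := run_branch (n := x.n) (d := 4) (φ := .ex (.free 6 4)) (by decide)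
    (Form.branch 4 (.badColoring 4) printNo (printYes (.seq (printClass 1) (printClass 2))))
    (Form.branch 4 (.ex (.inConflict 6 4)) printNo (printYes (printClass 1))) s₀
  have hφ : (Form.ex (.free 6 4)).Holds x.n 4 s₀ ↔ ∃ v, x.graph.IsFree v :=
    exists_congr fun _ => holds_free hm .new
  rw [hφ] at h₁ h₂
  rw [← hs'.2.1] at hm
  rw [← hs'.2.2] at ho'
  by_cases hfree : ∃ v, x.graph.IsFree v
  · rw [h₁ hfree]
    obtain ⟨s₁, hs₁, h₁, h₂⟩ := run_branch (n := x.n) (d := 4) (φ := .badColoring 4) (by decide)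
      printNo (printYes (.seq (printClass 1) (printClass 2))) s'
    rw [holds_badColoring hm] at h₁ h₂
    rw [← hs₁.2.1] at hm
    rw [← hs₁.2.2] at ho'
    by_cases hbad : ∃ u w, (x.graph.Linked u w ∧ ¬ c u = c w) ∨ (x.graph.Conflict u w ∧ c u = c w)
    · refine .inr ⟨fun ⟨𝒦, h𝒦, hcard⟩ => ?_, ?_⟩
      · have hg := isGoodColoring_greedyColoring (h𝒦.exists_isGoodColoring x.no_isolated hcard)
        obtain ⟨u, w, ⟨hl, hne⟩ | ⟨hl, he⟩⟩ := hbad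
        exacts [hne (hg.2.1 u w hl), hg.2.2 u w hl he]
      · rw [h₁ hbad]; simp [printNo, LoopProg.run, State.emit, ho', Expr.eval]
    · have hg : x.graph.IsGoodColoring c := by
        refine ⟨fun v => ?_, fun u w hl => ?_, fun u w hl he => hbad ⟨u, w, .inr ⟨hl, he⟩⟩⟩
        · have h1 := greedyColoring_ne_zero (G := x.graph) v
          have h2 := greedyColoring_le (G := x.graph) v
          change x.graph.greedyColoring v = 1 ∨ x.graph.greedyColoring v = 2
          omega
        · by_contra hne; exact hbad ⟨u, w, .inl ⟨hl, hne⟩⟩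
      obtain ⟨s₂, he, harr, hout⟩ := run_printYes hm (.seq (printClass 1) (printClass 2))
      rw [← harr] at hm
      obtain ⟨k₁, k₂⟩ := run_printClass hm 1
      rw [← k₁] at hm
      obtain ⟨-, k₃⟩ := run_printClass hm 2
      refine .inl ⟨repCliques x.graph ++ ([colorClique x.graph c 1] ++ [colorClique x.graph c 2]),
        isEdgeCliqueCover_repCliques_append _ (fun K hK => ?_) (fun u w huw => ?_), ?_, ?_⟩
      · simp only [List.cons_append, List.nil_append, List.mem_cons, List.not_mem_nil,
          or_false] at hK
        rcases hK with rfl | rfl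
        · simpa [colorClique] using hg.isClique 1
        · simpa [colorClique] using hg.isClique 2
      · rcases hg.exists_inColorClass huw with hh | hh
        · exact ⟨colorClique x.graph c 1, by simp, by simpa [colorClique] using hh⟩
        · exact ⟨colorClique x.graph c 2, by simp, by simpa [colorClique] using hh⟩
      -- The free vertex gives r + 1 ≤ α, so the two colour classes fit within α + 1.
      · obtain ⟨v, hv⟩ := hfree
        have := hv.card_reps_lt_indepNum
        simp only [List.length_append, length_repCliques, List.length_singleton]
        omega
      · rw [h₂ hbad, he, LoopProg.run, k₃, k₂, hout, ho', encodeSets_append, encodeSets_append,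
          encodeSets_colorClique, encodeSets_colorClique]
        simp
  · rw [h₂ hfree]
    obtain ⟨s₁, hs₁, h₁, h₂⟩ := run_branch (n := x.n) (d := 4) (φ := .ex (.inConflict 6 4))
      (by decide) printNo (printYes (printClass 1)) s'
    have hφ : (Form.ex (.inConflict 6 4)).Holds x.n 4 s' ↔ ∃ v, x.graph.InConflict v :=
      exists_congr fun _ => holds_inConflict hm .new
    rw [hφ] at h₁ h₂
    rw [← hs₁.2.1] at hm
    rw [← hs₁.2.2] at ho'
    by_cases hcf : ∃ v, x.graph.InConflict v
    · refine .inr ⟨fun ⟨𝒦, h𝒦, hcard⟩ => ?_, ?_⟩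
      · obtain ⟨u, w, huw⟩ := hcf
        exact h𝒦.not_conflict x.no_isolated hcard hfree u w huw
      · rw [h₁ hcf]; simp [printNo, LoopProg.run, State.emit, ho', Expr.eval]
    -- Without conflicts the class of colour 1 consists of all endpoints of uncovered edges,
    -- whatever the colouring is.
    · obtain ⟨s₂, he, harr, hout⟩ := run_printYes hm (printClass 1)
      rw [← harr] at hm
      obtain ⟨k₁, k₂⟩ := run_printClass hm 1
      refine .inl ⟨repCliques x.graph ++ [colorClique x.graph c 1],
        isEdgeCliqueCover_repCliques_append _ (fun K hK => ?_) (fun u w huw => ?_), ?_, ?_⟩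
      · rw [List.mem_singleton] at hK
        subst hK
        intro u hu w hw hne
        by_contra ha
        simp only [colorClique, Finset.coe_filter, Finset.mem_univ, true_and] at hu hw
        exact hcf ⟨u, w, hu.1, hw.1, hne, ha⟩
      · refine ⟨colorClique x.graph c 1, by simp, ?_, ?_⟩
        · simpa [colorClique] using ⟨⟨w, huw⟩, .inl fun h => hcf ⟨u, h⟩⟩
        · simpa [colorClique] using ⟨⟨u, huw.symm⟩, .inl fun h => hcf ⟨w, h⟩⟩
      · have := card_reps_le_indepNum (G := x.graph)
        simp only [List.length_append, length_repCliques, List.length_singleton]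
        omega
      · rw [h₂ hcf, he, k₂, hout, ho', encodeSets_append, encodeSets_colorClique]
        simp

/-! ### Decoding the input and the final time bound -/

/-- Compute the square root of register `0` in register `2`. -/
def sqrtProg : Prog :=
  .while (.lt (.reg 3) (.reg 0)) (.seq
    (.set 3 (.add (.add (.reg 3) (.reg 2)) (.add (.reg 2) (.const 1))))
    (.set 2 (.add (.reg 2) (.const 1))))

/-- Register `3` keeps the square of register `2`, updated by (i + 1)² = i² + i + (i + 1). A round
costs 4 + 8 + 4 = 16, the last guard 4. -/
theorem exec_sqrtProg {n : ℕ} (k i : ℕ) (hk : i + k = n) (s : State) (h0 : s.reg 0 = n * n)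
    (h2 : s.reg 2 = i) (h3 : s.reg 3 = i * i) :
    ∃ s' t, Exec sqrtProg s s' t ∧ t ≤ k * 16 + 4 ∧ s'.reg 2 = n ∧ s'.arr = s.arr ∧
      s'.out = s.out := by
  induction k generalizing i s with
  | zero =>
    obtain rfl : i = n := by omega
    exact ⟨s, _, .while_false (by simp [Expr.eval, h0, h3]), by simp [Expr.cost], h2, rfl, rfl⟩
  | succ k ih =>
    have hlt : i * i < n * n := Nat.mul_self_lt_mul_self (by omega)
    obtain ⟨s', t, hs', ht, h⟩ := ih (i + 1) (by omega)
      ((s.setReg 3 (i * i + i + (i + 1))).setReg 2 (i + 1)) (by simp [State.setReg, h0])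
      (by simp [State.setReg]) (by simp [State.setReg]; ring)
    refine ⟨s', 4 + (8 + 4) + t, .while_true (by simp [Expr.eval, h0, h3, hlt])
      (.seq (.set _ _ _) (.set _ _ _)) ?_, by omega, h⟩
    rw [show Expr.eval s (.add (.add (.reg 3) (.reg 2)) (.add (.reg 2) (.const 1))) =
      i * i + i + (i + 1) by simp [Expr.eval, h2, h3], show Expr.eval (s.setReg 3 _)
      (.add (.reg 2) (.const 1)) = i + 1 by simp [Expr.eval, State.setReg, h2]]
    exact hs'

theorem length_encode (x : Instance) : (encode x).length = x.n * x.n := by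
  simp [encode, List.length_flatMap]

open Classical in
theorem getElem?_encode (x : Instance) (u v : Fin x.n) :
    (encode x)[(u * x.n + v : ℕ)]? = some (decide (x.graph.Adj u v)) := by
  have hdiv : ∀ a b : Fin x.n, (a * x.n + b : ℕ) / x.n = a := fun a b => by
    rw [mul_comm, Nat.mul_add_div (Nat.zero_lt_of_lt a.2), Nat.div_eq_of_lt b.2, add_zero]
  have hmod : ∀ a b : Fin x.n, (a * x.n + b : ℕ) % x.n = b := fun a b => by
    rw [mul_comm, Nat.mul_add_mod, Nat.mod_eq_of_lt b.2]
  have he : encode x = List.ofFn fun i : Fin (x.n * x.n) =>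
      decide (x.graph.Adj i.divNat i.modNat) := by
    rw [List.ofFn_mul, encode, List.flatMap_def, ← List.ofFn_eq_map]
    congr 2
    funext a
    rw [← List.ofFn_eq_map]
    congr 1
    funext b
    simp [Fin.divNat, Fin.modNat, hdiv, hmod]
  have hlt : (u * x.n + v : ℕ) < x.n * x.n :=
    calc (u * x.n + v : ℕ) < u * x.n + x.n := by omega
      _ = (u + 1) * x.n := by ring
      _ ≤ x.n * x.n := Nat.mul_le_mul_right _ u.2
  rw [he]
  simp [hlt, Fin.divNat, Fin.modNat, hdiv, hmod]

theorem eval_mono (p : Polynomial ℕ) {a b : ℕ} (h : a ≤ b) : p.eval a ≤ p.eval b := by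
  simp only [Polynomial.eval_eq_sum]
  exact Finset.sum_le_sum fun i _ => Nat.mul_le_mul_left _ (Nat.pow_le_pow_left h i)

theorem solvableInPolyTime_of_loopProg {k : ℕ} (P : LoopProg) (hP : P.Wf)
    (h : ∀ (x : Instance) (s : State), IsStart x.graph s → IsAnswer k x (P.run x.n s).out) :
    SolvableInPolyTime encode (IsAnswer k) := by
  refine ⟨.seq sqrtProg P.toProg, .X * (16 : ℕ) + (4 : ℕ) + P.time, fun x => ?_⟩
  obtain ⟨s, t, hs, ht, h2, harr, hout⟩ := exec_sqrtProg (n := x.n) x.n 0 (by omega)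
    (State.init (encode x)) (by simp [State.init, length_encode]) (by simp [State.init])
    (by simp [State.init])
  obtain ⟨t', ht', h'⟩ := exec_toProg hP s h2
  refine ⟨_, _, .seq hs h', ?_, h x s ⟨h2, fun u v => ?_, fun i => ?_, ?_⟩⟩
  · rw [length_encode]
    -- The bound is a polynomial in `n`; as n ≤ n², the same polynomial works for the input length.
    refine le_trans ?_ (eval_mono _ (Nat.le_mul_self x.n))
    simp only [Polynomial.eval_add, Polynomial.eval_mul, Polynomial.eval_X,
      Polynomial.eval_natCast, Nat.cast_id]
    omega
  · rw [harr]; simp [State.init, getElem?_encode]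
  · rw [harr]; simp [State.init]
  · rw [hout]; rfl

end Programs

end ECCAboveIndependentSet

theorem theorem3 (k : ℕ) (hk : k = 0 ∨ k = 1) :
    RAM.SolvableInPolyTime ECCAboveIndependentSet.encode (ECCAboveIndependentSet.IsAnswer k) := by
  rcases hk with rfl | rfl
  · exact ECCAboveIndependentSet.solvableInPolyTime_of_loopProg _ RAM.LoopProg.coverProg_wf
      fun x _ h => ECCAboveIndependentSet.run_coverProg x h
  · exact ECCAboveIndependentSet.solvableInPolyTime_of_loopProg _ RAM.LoopProg.coverSuccProg_wf
      fun x _ h => ECCAboveIndependentSet.run_coverSuccProg x h
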